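/- **Setting.** Let $G=(V,E)$ be a finite connected simple graph on $n$ vertices with maximum degree $\Delta$ and minimum degree $\delta$. A set of $n$ agents is partitioned into $t\ge 3$ types; write $\tau(A)$ for the type of agent $A$ and put $k=\lfloor n/t\rfloor$. The agents are equitable: every type has $k$ or $k+1$ agents. An assignment $L$ is a bijection from agents to vertices; two agents are neighbours if their locations are adjacent. Consider the utilities of an agent $A$: $U_b(A)=1$ if some neighbour has a type different from $\tau(A)$, and $0$ otherwise; $U_\#(A)$ is the number of neighbours of type different from $\tau(A)$; $U_\tau(A)$ is the number of types different from $\tau(A)$ occurring among the neighbours of $A$. For a utility $U$, $L$ is an equilibrium if no two agents can both strictly increase their utility by interchanging their locations. Let $\mathrm{ce}(L)$ be the number of edges whose endpoints carry agents of different types, and $\mathrm{sw}(L,U)=\sum_A U(A)$. For a measure $\mu$, $PoA(\mu,U,G)=\max_L\mu(L)/\min_{L\text{ equilibrium}}\mu(L)$ and $PoS(\mu,U,G)=\max_L\mu(L)/\max_{L\text{ equilibrium}}\mu(L)$. **The graph $G^*$.** For $1\le d\le q$ let $R(2q,d)$ be the bipartite graph with sides $a_1,\dots,a_q$ and $b_1,\dots,b_q$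 in which $a_j$ is joined to $b_j,b_{j+1},\dots,b_{j+d-1}$ (indices mod $q$); $R(2q,0)$ has no edges. For $t\ge3$, $\delta\ge1$ and $q\ge\max(\delta,t-1)$, $G^*$ is the following graph on $2qt$ vertices. Take copies $H_1,\dots,H_{t-1}$ of $R(2q,\delta-1)$ and a copy $H_t$ of $R(2q,\delta)$, and write $a_{ij},b_{ij}$ for the vertices of $H_i$. For $1\le i\le t-1$ (cyclically, with $H_1$ following $H_{t-1}$) join $b_{ij}$ to $a_{i+1,j}$ for all $j\ne1$. Remove the edges $a_{ti}b_{ti}$ and add the edges $b_{i1}a_{ti}$ and $a_{i1}b_{ti}$ for $1\le i\le t-1$. **Theorem.** (0) If $n\ge2$, then each of $U_b,U_\#,U_\tau$ has an equilibrium, and $\mathrm{ce}(L)>0$ for every assignment $L$. (1) For every $\varepsilon>0$ there is $K$ such that $PoA(\mathrm{ce},U_b,G)\le(1+\varepsilon)\frac{\Delta t}{t-1}$ whenever $k\ge K$. This is tight on $G^*$: $G^*$ is $\delta$-regular and, for fixed $t\ge3$ and $\delta\ge1$ and with equitable agents, $PoA(\mathrm{ce},U_b,G^*)\to\frac{\delta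 t}{t-1}$ as $q\to\infty$. Moreover $PoS(\mathrm{ce},U_b,G^*)=1$. (2) $PoA(\mathrm{ce},U_\#,G)=PoA(\mathrm{sw}(\cdot,U_\#),U_\#,G)$. For every $\varepsilon>0$ there is $K$ such that $PoA(\mathrm{ce},U_\#,G)\le(1+\varepsilon)\frac{2\Delta}{\delta}$ whenever $k\ge K$. Furthermore: (i) for every $\varepsilon>0$ there are $C,K$ such that $1\le PoA(\mathrm{ce},U_\#,G)\le(1+\varepsilon)\frac{\Delta}{\delta}$ whenever $k\ge K$ and $t\ge C(1+\delta\log\delta)$ (so on regular graphs the price of anarchy tends to $\Delta/\delta=1$); (ii) for all $a,b>0$ there is $c>0$ such that for every $\varepsilon>0$ there is $K$ with $$PoA(\mathrm{ce},U_\#,G)\le(1+\varepsilon)\,\frac{2}{\frac{\delta}{\Delta}+c\left(\frac{t^2}{\delta\Delta}-\frac1\Delta\right)}\quad\text{whenever } k\ge K \text{ and } a\sqrt\delta\le t\le b\delta.$$ (3) For every $\varepsilon>0$ there is $K$ such that $PoA(\mathrm{ce},U_\tau,G)\le(1+\varepsilon)\frac{\Delta t}{t-1}$ whenever $k\ge K$.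 Furthermore: (i) for every $\varepsilon>0$ there are $C,K$ such that $1\le PoA(\mathrm{ce},U_\tau,G)\le(1+\varepsilon)\frac{\Delta}{\delta}$ whenever $k\ge K$ and $t\ge C\delta^3$; (ii) for every $b>0$ there is $C>0$ such that $PoA(\mathrm{ce},U_\tau,G)\le C\,\Delta/t^{1/3}$ whenever $k\ge1$ and $t\le b\delta^3$. (4) If $n\ge2$ and $t\ge\Delta+1$, then $PoS(\mathrm{ce},U_\#,G)=1$. All constants $K,C,c$ depend only on the quantities quantified before them, not on $G$, $n$, $t$, $\delta$, $\Delta$. -/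

import Mathlib

open Filter Topology

universe u v

namespace SwapGame

section Game

variable {V : Type u} {X : Type v} [Fintype X] {t : ℕ}

/-- The agents adjacent to agent `A` when the agents are placed on the vertices of `G` by `L`. -/
noncomputable def nbrs (G : SimpleGraph V) (L : X ≃ V) (A : X) : Finset X :=
  open Classical in Finset.univ.filter fun B => G.Adj (L A) (L B)

/-- Binary utility: `1` if some neighbour has another type, `0` otherwise. -/
noncomputable def uBinary (G : SimpleGraph V) (typ : X → Fin t) (L : X ≃ V) (A : X) : ℝ :=
  open Classical in if ∃ B ∈ nbrs G L A, typ B ≠ typ A then 1 else 0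

/-- Difference-seeking utility: the number of neighbours of another type. -/
noncomputable def uDiff (G : SimpleGraph V) (typ : X → Fin t) (L : X ≃ V) (A : X) : ℝ :=
  (((nbrs G L A).filter fun B => typ B ≠ typ A).card : ℝ)

/-- Variety-seeking utility: the number of types other than the agent's own type that occur
among its neighbours. -/
noncomputable def uVariety (G : SimpleGraph V) (typ : X → Fin t) (L : X ≃ V) (A : X) : ℝ :=
  ((((nbrs G L A).image typ).erase (typ A)).card : ℝ)

/-- The assignment in which `A` and `B` have interchanged their locations. -/
noncomputable def swapped (L : X ≃ V) (A B : X) : X ≃ V :=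
  open Classical in (Equiv.swap A B).trans L

/-- `L` is an equilibrium for the utility `U` if no two agents can both strictly increase their
utility by interchanging their locations. -/
def IsEquilibrium (U : (X ≃ V) → X → ℝ) (L : X ≃ V) : Prop :=
  ¬ ∃ A B : X, U L A < U (swapped L A B) A ∧ U L B < U (swapped L A B) B

/-- Social welfare. -/
noncomputable def socialWelfare (U : (X ≃ V) → X → ℝ) (L : X ≃ V) : ℝ :=
  ∑ A, U L A

/-- The number of colorful edges, i.e. edges of `G` whose endpoints are occupied by agents of
different types. -/
noncomputable def colorfulEdges (G : SimpleGraph V) (typ : X → Fin t) (L : X ≃ V) : ℝ :=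
  (({e ∈ G.edgeSet | ¬ (e.map (typ ∘ L.symm)).IsDiag} : Set (Sym2 V)).ncard : ℝ)

/-- Price of anarchy: the maximum of `μ` over all assignments divided by its minimum over all
equilibrium assignments. -/
noncomputable def priceOfAnarchy (μ : (X ≃ V) → ℝ) (U : (X ≃ V) → X → ℝ) : ℝ :=
  (⨆ L : X ≃ V, μ L) / (⨅ L : {L : X ≃ V // IsEquilibrium U L}, μ L)

/-- Price of stability: the maximum of `μ` over all assignments divided by its maximum over all
equilibrium assignments. -/
noncomputable def priceOfStability (μ : (X ≃ V) → ℝ) (U : (X ≃ V) → X → ℝ) : ℝ :=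
  (⨆ L : X ≃ V, μ L) / (⨆ L : {L : X ≃ V // IsEquilibrium U L}, μ L)

/-- There are as many agents as vertices, say `n`, and every type has `⌊n / t⌋` or
`⌊n / t⌋ + 1` agents. -/
structure Equitable (V : Type u) [Fintype V] (typ : X → Fin t) : Prop where
  card_eq : Fintype.card X = Fintype.card V
  card_type : ∀ i : Fin t,
    (Finset.univ.filter fun A => typ A = i).card = Fintype.card V / t ∨
    (Finset.univ.filter fun A => typ A = i).card = Fintype.card V / t + 1

/-- The standing assumptions: a connected graph and equitable agents of at least three types. -/
structure Setting [Fintype V] (G : SimpleGraph V) (typ : X → Fin t) : Prop where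
  connected : G.Connected
  three_le : 3 ≤ t
  equitable : Equitable V typ

end Game

section GStar

/-- Adjacency of `a_j` and `b_l` in the bipartite `d`-regular graph `R(2q, d)`:
`a_j` is joined to `b_j, b_{j+1}, …, b_{j+d-1}`, with indices modulo `q`. -/
def rEdge (q d : ℕ) (j l : Fin q) : Prop :=
  ∃ s < d, (l : ℕ) = ((j : ℕ) + s) % q

/-- Adjacency in `G*` of the vertex `x.2` of the side `A_{x.1}` and the vertex `y.2` of the side
`B_{y.1}`. All indices start from `0`: the copies of `R(2q, d - 1)` are the blocks `0, …, t - 2`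
and the modified copy of `R(2q, d)` is the block `t - 1`. -/
def gStarEdge (t d q : ℕ) (x y : Fin t × Fin q) : Prop :=
  -- inside one of the first `t - 1` blocks
  ((x.1 : ℕ) < t - 1 ∧ x.1 = y.1 ∧ rEdge q (d - 1) x.2 y.2) ∨
  -- the matching from `B_i` to `A_{i+1}`, cyclically in the first `t - 1` blocks,
  -- without the edge at index `0`
  ((x.1 : ℕ) < t - 1 ∧ (y.1 : ℕ) < t - 1 ∧ (x.1 : ℕ) = ((y.1 : ℕ) + 1) % (t - 1) ∧
    x.2 = y.2 ∧ (x.2 : ℕ) ≠ 0) ∨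
  -- inside the last block, where the edges between `a_j` and `b_j` for `j < t - 1` are removed
  ((x.1 : ℕ) = t - 1 ∧ (y.1 : ℕ) = t - 1 ∧ rEdge q d x.2 y.2 ∧
    ¬ (x.2 = y.2 ∧ (x.2 : ℕ) < t - 1)) ∨
  -- the vertex `0` of `B_i` is joined to the vertex `i` of `A_{t-1}`
  ((x.1 : ℕ) = t - 1 ∧ (y.1 : ℕ) < t - 1 ∧ (y.2 : ℕ) = 0 ∧ (x.2 : ℕ) = (y.1 : ℕ)) ∨
  -- the vertex `0` of `A_i` is joined to the vertex `i` of `B_{t-1}`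
  ((x.1 : ℕ) < t - 1 ∧ (y.1 : ℕ) = t - 1 ∧ (x.2 : ℕ) = 0 ∧ (y.2 : ℕ) = (x.1 : ℕ))

/-- The `d`-regular graph `G*` on `2qt` vertices; `Sum.inl (i, j)` is the vertex `j` of the side
`A_i` and `Sum.inr (i, j)` is the vertex `j` of the side `B_i`. -/
def gStar (t d q : ℕ) : SimpleGraph ((Fin t × Fin q) ⊕ (Fin t × Fin q)) where
  Adj
    | Sum.inl x, Sum.inr y => gStarEdge t d q x y
    | Sum.inr y, Sum.inl x => gStarEdge t d q x y
    | _, _ => False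
  symm := ⟨by
    rintro (x | x) (y | y) h <;> exact h⟩
  loopless := ⟨by
    rintro (x | x) h <;> exact h⟩

end GStar

end SwapGame

/-! An assignment matters only through the colouring `typ ∘ L.symm` of the vertices, and an exchange
of two agents is `swapColor`. Twice the number of colourful edges is the sum of `numOther` over the
vertices.

For all three utilities an improving swap strictly increases the number of colourful edges
(`IsPotential`). So a maximizer of `colorfulEdges` is an equilibrium, which gives existence and
price of stability 1. As `colorfulEdges` is at most `n Δ / 2`, every upper bound on the price of
anarchy reduces to a lower bound `m` on the sum of `numOther` in an equilibrium
(`priceOfAnarchy_le`).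

The lower bounds come from swaps that must fail in an equilibrium. For the binary and variety
utilities, two vertices of different colours without colourful neighbours would swap, so all such
vertices lie in one colour class (`card_le_sum_numOther_add`). For the difference utility, two
vertices of different colours have at least `δ` colourful neighbours together, and more than `δ` if
adjacent, so the average exceeds `δ / 2` by a constant (`le_sum_numOther`). With many types a
tournament argument is stronger: of any two colours containing poor vertices, one must be frequent
around a poor vertex of the other, while few colours are frequent around a vertex. Hence poor
vertices occupy few colours (`card_numOther_add_le`, and `card_numOther_lt_le` for variety).

On `G*` the colouring by blocks is an equilibrium with about one colourful edge per vertex of the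
first `t - 1` blocks, whereas colouring pairs of sides makes all edges but at most one colourful. -/

namespace SwapGame

/-! ### Colourings, and the change of the number of colourful edges under a swap. -/

section Coloring

open Classical in
/-- The number of neighbours of `v` in `G`. -/
noncomputable def numNbrs {V : Type*} [Fintype V] (G : SimpleGraph V) (v : V) : ℕ :=
  (Finset.univ.filter fun y => G.Adj v y).card

open Classical in
/-- The number of neighbours of `v` of colour `i`. -/
noncomputable def colorCount {V ι : Type*} [Fintype V] (G : SimpleGraph V) (c : V → ι) (v : V)
    (i : ι) : ℕ :=
  (Finset.univ.filter fun y => G.Adj v y ∧ c y = i).card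

open Classical in
/-- The number of neighbours of `v` whose colour is not that of `v`. -/
noncomputable def numOther {V ι : Type*} [Fintype V] (G : SimpleGraph V) (c : V → ι) (v : V) : ℕ :=
  (Finset.univ.filter fun y => G.Adj v y ∧ c y ≠ c v).card

open Classical in
/-- The number of neighbours of `x` of colour `i` outside of `{v, w}`. -/
noncomputable def countOff {V ι : Type*} [Fintype V] (G : SimpleGraph V) (c : V → ι) (v w x : V)
    (i : ι) : ℕ :=
  (Finset.univ.filter fun y => y ≠ v ∧ y ≠ w ∧ G.Adj x y ∧ c y = i).card

open Classical in
/-- The set of colours of the neighbours of `v`. -/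
noncomputable def nbrColors {V ι : Type*} [Fintype V] (G : SimpleGraph V) (c : V → ι) (v : V) :
    Finset ι :=
  (Finset.univ.filter fun y => G.Adj v y).image c

open Classical in
/-- The colouring in which the colours of `v` and `w` have been interchanged. -/
noncomputable def swapColor {V ι : Type*} (c : V → ι) (v w : V) : V → ι :=
  fun x => c (Equiv.swap v w x)

variable {V ι : Type*}

lemma swapColor_left (c : V → ι) (v w : V) : swapColor c v w v = c w := by
  simp [swapColor]

lemma swapColor_right (c : V → ι) (v w : V) : swapColor c v w w = c v := by
  simp [swapColor]

lemma swapColor_of_ne (c : V → ι) {v w x : V} (hv : x ≠ v) (hw : x ≠ w) :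
    swapColor c v w x = c x := by
  classical
  simp [swapColor, Equiv.swap_apply_of_ne_of_ne hv hw]

lemma swapColor_comm (c : V → ι) (v w : V) : swapColor c v w = swapColor c w v := by
  funext x
  simp [swapColor, Equiv.swap_comm]

lemma swapColor_eq_self (c : V → ι) {v w : V} (h : c v = c w) : swapColor c v w = c := by
  funext x
  by_cases hv : x = v
  · subst hv; rw [swapColor_left, h]
  by_cases hw : x = w
  · subst hw; rw [swapColor_right, h]
  exact swapColor_of_ne c hv hw

variable [Fintype V] (G : SimpleGraph V) (c : V → ι)

lemma mem_nbrColors {v : V} {i : ι} : i ∈ nbrColors G c v ↔ ∃ y, G.Adj v y ∧ c y = i := by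
  simp [nbrColors]

lemma countOff_comm (v w x : V) (i : ι) : countOff G c v w x i = countOff G c w v x i := by
  unfold countOff
  congr 1
  ext y
  simp only [Finset.mem_filter, Finset.mem_univ, true_and]
  tauto

lemma countOff_pos {v w x : V} {i : ι} :
    0 < countOff G c v w x i ↔ ∃ y, y ≠ v ∧ y ≠ w ∧ G.Adj x y ∧ c y = i := by
  simp [countOff, Finset.card_pos, Finset.Nonempty]

lemma countOff_eq_zero {v w x : V} {i : ι} :
    countOff G c v w x i = 0 ↔ ∀ y, y ≠ v → y ≠ w → G.Adj x y → c y ≠ i := by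
  rw [← not_iff_not, ← ne_eq, ← Nat.pos_iff_ne_zero, countOff_pos]
  push Not
  rfl

lemma colorCount_pos {v : V} {i : ι} : 0 < colorCount G c v i ↔ ∃ y, G.Adj v y ∧ c y = i := by
  simp [colorCount, Finset.card_pos, Finset.Nonempty]

lemma colorCount_add_numOther (v : V) : colorCount G c v (c v) + numOther G c v = numNbrs G v := by
  classical
  unfold colorCount numOther numNbrs
  rw [← Finset.card_filter_add_card_filter_not (s := Finset.univ.filter fun y => G.Adj v y)
    (fun y => c y = c v), Finset.filter_filter, Finset.filter_filter]

lemma numOther_le_numNbrs (v : V) : numOther G c v ≤ numNbrs G v := by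
  have := colorCount_add_numOther G c v
  omega

lemma colorCount_le_numOther {v : V} {i : ι} (h : i ≠ c v) :
    colorCount G c v i ≤ numOther G c v := by
  classical
  unfold colorCount numOther
  refine Finset.card_le_card fun y hy => ?_
  simp only [Finset.mem_filter, Finset.mem_univ, true_and] at hy ⊢
  exact ⟨hy.1, hy.2 ▸ h⟩

lemma countOff_le_colorCount (v w x : V) (i : ι) : countOff G c v w x i ≤ colorCount G c x i := by
  classical
  refine Finset.card_le_card fun y hy => ?_
  simp only [Finset.mem_filter, Finset.mem_univ, true_and] at hy ⊢
  exact hy.2.2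

lemma countOff_lt_colorCount {v w : V} (h : G.Adj v w) :
    countOff G c v w w (c v) < colorCount G c w (c v) := by
  classical
  refine Finset.card_lt_card (Finset.ssubset_iff_subset_ne.2 ⟨fun y hy => ?_, fun he => ?_⟩)
  · simp only [Finset.mem_filter, Finset.mem_univ, true_and] at hy ⊢
    exact hy.2.2
  · have : v ∈ Finset.univ.filter fun y => y ≠ v ∧ y ≠ w ∧ G.Adj w y ∧ c y = c v := by
      rw [he]
      simp [h.symm]
    simp at this

lemma colorCount_self_eq_countOff {v w : V} (h : c v ≠ c w) :
    colorCount G c v (c v) = countOff G c v w v (c v) := by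
  classical
  unfold colorCount countOff
  congr 1
  ext y
  simp only [Finset.mem_filter, Finset.mem_univ, true_and]
  constructor
  · rintro ⟨h1, h2⟩
    refine ⟨fun e => G.loopless.irrefl _ (e ▸ h1), fun e => h (by rw [← h2, e]), h1, h2⟩
  · exact fun h => h.2.2

lemma colorCount_swapColor_right {v w : V} (h : c v ≠ c w) :
    colorCount G (swapColor c v w) w (c v) = countOff G c v w w (c v) := by
  classical
  unfold colorCount countOff
  congr 1
  ext y
  simp only [Finset.mem_filter, Finset.mem_univ, true_and]
  constructor
  · rintro ⟨h1, h2⟩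
    have hw : y ≠ w := fun e => G.loopless.irrefl _ (e ▸ h1)
    have hv : y ≠ v := by
      rintro rfl
      rw [swapColor_left] at h2
      exact h h2.symm
    exact ⟨hv, hw, h1, by rwa [swapColor_of_ne c hv hw] at h2⟩
  · rintro ⟨hv, hw, h1, h2⟩
    exact ⟨h1, by rwa [swapColor_of_ne c hv hw]⟩

lemma colorCount_swapColor_left {v w : V} (h : c v ≠ c w) :
    colorCount G (swapColor c v w) v (c w) = countOff G c v w v (c w) := by
  rw [swapColor_comm, countOff_comm, colorCount_swapColor_right G c h.symm]

open Classical in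
lemma colorCount_eq_sum_add (c : V → ι) {v w x : V} (hvw : v ≠ w) (i : ι) :
    colorCount G c x i = countOff G c v w x i + (if G.Adj x v ∧ c v = i then 1 else 0) +
      (if G.Adj x w ∧ c w = i then 1 else 0) := by
  unfold colorCount countOff
  simp only [Finset.card_filter]
  rw [← Finset.add_sum_erase _ _ (Finset.mem_univ v),
    ← Finset.add_sum_erase _ _ (show w ∈ Finset.univ.erase v by simp [hvw.symm]),
    ← Finset.add_sum_erase Finset.univ
      (fun y => if y ≠ v ∧ y ≠ w ∧ G.Adj x y ∧ c y = i then 1 else 0)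
      (Finset.mem_univ v),
    ← Finset.add_sum_erase (Finset.univ.erase v)
      (fun y => if y ≠ v ∧ y ≠ w ∧ G.Adj x y ∧ c y = i then 1 else 0)
      (show w ∈ Finset.univ.erase v by simp [hvw.symm])]
  have : ∑ y ∈ (Finset.univ.erase v).erase w, (if G.Adj x y ∧ c y = i then 1 else 0) =
      ∑ y ∈ (Finset.univ.erase v).erase w,
        (if y ≠ v ∧ y ≠ w ∧ G.Adj x y ∧ c y = i then 1 else 0) := by
    refine Finset.sum_congr rfl fun y hy => ?_
    simp only [Finset.mem_erase, Finset.mem_univ, and_true] at hy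
    simp [hy.1, hy.2]
  rw [this]
  simp
  ring

open Classical in
lemma sum_off_eq_countOff (c : V → ι) (v w x : V) (i : ι) :
    ∑ y ∈ Finset.univ.filter (fun y => y ≠ v ∧ y ≠ w), (if G.Adj y x ∧ i = c y then 1 else 0) =
      countOff G c v w x i := by
  rw [← Finset.card_filter, Finset.filter_filter]
  unfold countOff
  congr 1
  ext y
  simp only [Finset.mem_filter, Finset.mem_univ, true_and, G.adj_comm x y, eq_comm (a := i)]
  tauto

open Classical in
lemma sum_eq_add_add_sum_off (f : V → ℕ) {v w : V} (hvw : v ≠ w) :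
    ∑ x, f x = f v + f w + ∑ x ∈ Finset.univ.filter (fun x => x ≠ v ∧ x ≠ w), f x := by
  rw [← Finset.add_sum_erase _ _ (Finset.mem_univ v),
    ← Finset.add_sum_erase _ _ (show w ∈ Finset.univ.erase v by simp [hvw.symm]), add_assoc]
  congr 3
  ext x
  simp [and_comm]

/-- A monochromatic edge at `v` or `w` is seen from both of its ends, hence the factor 2; the pair
`v`, `w` contributes nothing because its colours differ. The last sum does not involve the colours
of `v` and `w`, so it survives a swap. -/
lemma sum_colorCount_eq {v w : V} (h : c v ≠ c w) :
    ∑ x, colorCount G c x (c x) =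
      2 * (countOff G c v w v (c v) + countOff G c v w w (c w)) +
      ∑ x ∈ (open Classical in Finset.univ.filter (fun x => x ≠ v ∧ x ≠ w)),
        countOff G c v w x (c x) := by
  classical
  have hvw : v ≠ w := fun e => h (e ▸ rfl)
  rw [sum_eq_add_add_sum_off _ hvw, colorCount_self_eq_countOff G c h,
    colorCount_self_eq_countOff G c h.symm, countOff_comm G c w v]
  simp_rw [colorCount_eq_sum_add G c hvw, Finset.sum_add_distrib]
  rw [sum_off_eq_countOff, sum_off_eq_countOff]
  ring

lemma countOff_swapColor (v w x : V) (i : ι) :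
    countOff G (swapColor c v w) v w x i = countOff G c v w x i := by
  classical
  unfold countOff
  congr 1
  ext y
  simp only [Finset.mem_filter, Finset.mem_univ, true_and]
  refine and_congr_right fun hv => and_congr_right fun hw => ?_
  rw [swapColor_of_ne c hv hw]

lemma sum_colorCount_swapColor {v w : V} (h : c v ≠ c w) :
    ∑ x, colorCount G (swapColor c v w) x (swapColor c v w x) =
      2 * (countOff G c v w v (c w) + countOff G c v w w (c v)) +
      ∑ x ∈ (open Classical in Finset.univ.filter (fun x => x ≠ v ∧ x ≠ w)),
        countOff G c v w x (c x) := by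
  classical
  rw [sum_colorCount_eq G (swapColor c v w) (v := v) (w := w)
    (by rw [swapColor_left, swapColor_right]; exact h.symm)]
  simp only [countOff_swapColor, swapColor_left, swapColor_right]
  congr 1
  refine Finset.sum_congr rfl fun x hx => ?_
  simp only [Finset.mem_filter, Finset.mem_univ, true_and] at hx
  rw [swapColor_of_ne c hx.1 hx.2]

/-- Monochromatic and colourful neighbours together make up the degrees, which a swap preserves;
losing monochromatic edges is gaining colourful ones. -/
lemma sum_numOther_lt_swapColor {v w : V} (h : c v ≠ c w)
    (hlt : countOff G c v w v (c w) + countOff G c v w w (c v) <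
      countOff G c v w v (c v) + countOff G c v w w (c w)) :
    ∑ x, numOther G c x < ∑ x, numOther G (swapColor c v w) x := by
  have h1 := Finset.sum_congr (s₁ := Finset.univ) rfl fun x _ => colorCount_add_numOther G c x
  have h2 := Finset.sum_congr (s₁ := Finset.univ) rfl
    fun x _ => colorCount_add_numOther G (swapColor c v w) x
  rw [Finset.sum_add_distrib] at h1 h2
  have h3 := sum_colorCount_eq G c h
  have h4 := sum_colorCount_swapColor G c h
  omega

end Coloring

/-! ### The three utilities of a colouring and their common potential. -/

section Coloring

variable {V ι : Type*} [Fintype V] (G : SimpleGraph V)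

lemma numOther_pos (c : V → ι) {v : V} :
    0 < numOther G c v ↔ ∃ y, G.Adj v y ∧ c y ≠ c v := by
  simp [numOther, Finset.card_pos, Finset.Nonempty]

lemma numNbrs_pos {v : V} : 0 < numNbrs G v ↔ ∃ y, G.Adj v y := by
  simp [numNbrs, Finset.card_pos, Finset.Nonempty]

open Classical in
/-- Binary utility of the agent on the vertex `v`. -/
noncomputable def binaryAt (c : V → ι) (v : V) : ℕ := if 0 < numOther G c v then 1 else 0

open Classical in
/-- Variety-seeking utility of the agent on the vertex `v`. -/
noncomputable def varietyAt (c : V → ι) (v : V) : ℕ := ((nbrColors G c v).erase (c v)).card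

lemma varietyAt_pos (c : V → ι) {v : V} : 0 < varietyAt G c v ↔ 0 < numOther G c v := by
  classical
  rw [numOther_pos]
  unfold varietyAt
  rw [Finset.card_pos]
  constructor
  · rintro ⟨i, hi⟩
    rw [Finset.mem_erase, mem_nbrColors] at hi
    obtain ⟨h, y, hy, rfl⟩ := hi
    exact ⟨y, hy, h⟩
  · rintro ⟨y, hy, h⟩
    exact ⟨c y, Finset.mem_erase.2 ⟨h, (mem_nbrColors G c).2 ⟨y, hy, rfl⟩⟩⟩

lemma varietyAt_le_numOther (c : V → ι) (v : V) : varietyAt G c v ≤ numOther G c v := by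
  classical
  unfold varietyAt numOther
  refine (Finset.card_le_card (t := (Finset.univ.filter fun y => G.Adj v y ∧ c y ≠ c v).image c)
    fun i hi => ?_).trans Finset.card_image_le
  rw [Finset.mem_erase, mem_nbrColors] at hi
  obtain ⟨h, y, hy, rfl⟩ := hi
  exact Finset.mem_image_of_mem _ (by simp [hy, h])

/-- The agents on `v` and `w` both gain by interchanging their locations. -/
def Improves (u : (V → ι) → V → ℕ) (c : V → ι) (v w : V) : Prop :=
  u c v < u (swapColor c v w) w ∧ u c w < u (swapColor c v w) v

omit [Fintype V] in
lemma Improves.color_ne {u : (V → ι) → V → ℕ} {c : V → ι} {v w : V} (h : Improves u c v w) :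
    c v ≠ c w := by
  intro e
  unfold Improves at h
  rw [swapColor_eq_self c e] at h
  omega

/-- The number of colourful edges increases in every improving swap. -/
def IsPotential (u : (V → ι) → V → ℕ) : Prop :=
  ∀ c v w, Improves u c v w → ∑ x, numOther G c x < ∑ x, numOther G (swapColor c v w) x

/-- Two vertices of different colours without a neighbour of another colour want to swap. -/
def UnhappySwap (u : (V → ι) → V → ℕ) : Prop :=
  ∀ c v w, c v ≠ c w → 0 < numNbrs G v → 0 < numNbrs G w → numOther G c v = 0 →
    numOther G c w = 0 → Improves u c v w

/-- In the sum of the two improvement inequalities the degrees of `v` and `w` occur on both sides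
and cancel. What remains is the hypothesis of `sum_numOther_lt_swapColor`. -/
lemma isPotential_numOther : IsPotential G (numOther G (ι := ι)) := by
  intro c v w hi
  have h := hi.color_ne
  obtain ⟨h1, h2⟩ := hi
  refine sum_numOther_lt_swapColor G c h ?_
  have a1 := colorCount_add_numOther G c v
  have a2 := colorCount_add_numOther G c w
  have a3 := colorCount_add_numOther G (swapColor c v w) v
  have a4 := colorCount_add_numOther G (swapColor c v w) w
  rw [swapColor_left, colorCount_swapColor_left G c h] at a3
  rw [swapColor_right, colorCount_swapColor_right G c h] at a4
  rw [colorCount_self_eq_countOff G c h] at a1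
  rw [colorCount_self_eq_countOff G c h.symm, countOff_comm] at a2
  omega

/-- A 0-1 utility can only rise from no colourful neighbour to some, so the swap also improves
`numOther` for both agents. -/
lemma isPotential_binaryAt : IsPotential G (binaryAt G (ι := ι)) := by
  intro c v w hi
  refine isPotential_numOther G c v w ?_
  obtain ⟨h1, h2⟩ := hi
  unfold binaryAt at h1 h2
  constructor
  · split_ifs at h1 <;> omega
  · split_ifs at h2 <;> omega

lemma not_adj_of_numOther_eq_zero {c : V → ι} {v w : V} (h : c v ≠ c w)
    (hv : numOther G c v = 0) : ¬ G.Adj v w := fun ha =>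
  (numOther_pos G c).2 ⟨w, ha, h.symm⟩ |>.ne' hv

/-- All neighbours of `w` have its colour and none of them is `v`, so they keep that colour and are
foreign to the agent arriving from `v`. -/
lemma numOther_swapColor_pos {c : V → ι} {v w : V} (h : c v ≠ c w) (hw : 0 < numNbrs G w)
    (hv0 : numOther G c v = 0) (hw0 : numOther G c w = 0) :
    0 < numOther G (swapColor c v w) w := by
  obtain ⟨y, hy⟩ := (numNbrs_pos G).1 hw
  refine (numOther_pos G _).2 ⟨y, hy, ?_⟩
  have hyw : y ≠ w := hy.ne'
  have hyv : y ≠ v := fun e => not_adj_of_numOther_eq_zero G h hv0 (e ▸ hy.symm)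
  rw [swapColor_right, swapColor_of_ne c hyv hyw]
  intro e
  exact not_adj_of_numOther_eq_zero G (w := y) (e ▸ h.symm) hw0 hy

lemma unhappySwap_of_pos_iff {u : (V → ι) → V → ℕ}
    (hu : ∀ c v, 0 < u c v ↔ 0 < numOther G c v) : UnhappySwap G u := by
  intro c v w h hv hw hv0 hw0
  have e1 : u c v = 0 := by have := hu c v; omega
  have e2 : u c w = 0 := by have := hu c w; omega
  constructor
  · rw [e1, hu]
    exact numOther_swapColor_pos G h hw hv0 hw0
  · rw [e2, hu, swapColor_comm]
    exact numOther_swapColor_pos G h.symm hv hw0 hv0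

lemma unhappySwap_binaryAt : UnhappySwap G (binaryAt G (ι := ι)) := by
  refine unhappySwap_of_pos_iff G fun c v => ?_
  unfold binaryAt
  split_ifs with h <;> simp [h]

lemma unhappySwap_varietyAt : UnhappySwap G (varietyAt G (ι := ι)) :=
  unhappySwap_of_pos_iff G fun c _ => varietyAt_pos G c

lemma nbrColors_swapColor_of_not_adj (c : V → ι) {v w : V} (h : ¬ G.Adj v w) :
    nbrColors G (swapColor c v w) w = nbrColors G c w := by
  ext i
  simp only [mem_nbrColors]
  refine exists_congr fun y => and_congr_right fun hy => ?_
  rw [swapColor_of_ne c (by rintro rfl; exact h hy.symm) hy.ne']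

lemma varietyAt_swapColor_of_not_adj (c : V → ι) {v w : V} (h : ¬ G.Adj v w) :
    varietyAt G (swapColor c v w) w = (open Classical in ((nbrColors G c w).erase (c v)).card) := by
  unfold varietyAt
  rw [nbrColors_swapColor_of_not_adj G c h, swapColor_right]

open Classical in
lemma varietyAt_of_adj (c : V → ι) {v w : V} (ha : G.Adj v w) (h : c v ≠ c w) :
    varietyAt G c v = (((nbrColors G c v).erase (c v)).erase (c w)).card + 1 := by
  unfold varietyAt
  rw [Finset.card_erase_add_one]
  exact Finset.mem_erase.2 ⟨h.symm, (mem_nbrColors G c).2 ⟨w, ha, rfl⟩⟩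

/-- A swap of `v` and `w` does not change the set of colours seen from a vertex, apart from the
colours of `v` and `w` themselves. -/
lemma nbrColors_swapColor_erase (c : V → ι) (v w x : V) :
    (open Classical in ((nbrColors G (swapColor c v w) x).erase (c v)).erase (c w)) =
      (open Classical in ((nbrColors G c x).erase (c v)).erase (c w)) := by
  classical
  ext i
  simp only [Finset.mem_erase, mem_nbrColors]
  refine and_congr_right fun hw => and_congr_right fun hv => exists_congr fun y =>
    and_congr_right fun _ => ?_
  by_cases e1 : y = v
  · subst e1
    rw [swapColor_left]
    exact ⟨fun e => (hw e.symm).elim, fun e => (hv e.symm).elim⟩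
  by_cases e2 : y = w
  · subst e2
    rw [swapColor_right]
    exact ⟨fun e => (hv e.symm).elim, fun e => (hw e.symm).elim⟩
  rw [swapColor_of_ne c e1 e2]

/-- If `v` and `w` are adjacent, each agent sees the colour of the other before and after the swap,
and the remaining colours seen from a location do not change. The two gains would then be opposite
strict inequalities. -/
lemma Improves.not_adj_of_varietyAt {c : V → ι} {v w : V} (hi : Improves (varietyAt G) c v w) :
    ¬ G.Adj v w := by
  classical
  intro ha
  have h := hi.color_ne
  obtain ⟨h1, h2⟩ := hi
  have hs : swapColor c v w v ≠ swapColor c v w w := by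
    rw [swapColor_left, swapColor_right]; exact h.symm
  rw [varietyAt_of_adj G c ha h, varietyAt_of_adj G _ ha.symm hs.symm, swapColor_left,
    swapColor_right, nbrColors_swapColor_erase] at h1
  rw [varietyAt_of_adj G c ha.symm h.symm, varietyAt_of_adj G _ ha hs, swapColor_left,
    swapColor_right, Finset.erase_right_comm (a := c w),
    Finset.erase_right_comm (a := c w) (b := c v), nbrColors_swapColor_erase] at h2
  omega

/-- For the variety-seeking utility a swap is improving if and only if each of the two agents
has a neighbour of its own type, sees no agent of the type of the other, and both see the same
number of types. -/
lemma improves_varietyAt_iff (c : V → ι) (v w : V) : Improves (varietyAt G) c v w ↔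
    c v ∈ nbrColors G c v ∧ c w ∉ nbrColors G c v ∧ c w ∈ nbrColors G c w ∧
      c v ∉ nbrColors G c w ∧ (nbrColors G c v).card = (nbrColors G c w).card := by
  classical
  have key : ¬ G.Adj v w → (Improves (varietyAt G) c v w ↔ _) := fun ha => by
    unfold Improves
    rw [varietyAt_swapColor_of_not_adj G c ha, swapColor_comm,
      varietyAt_swapColor_of_not_adj G c (fun h => ha h.symm)]
  constructor
  · intro hi
    rw [key (hi.not_adj_of_varietyAt G)] at hi
    unfold varietyAt at hi
    -- Erasing one colour lowers a cardinality by at most 1, so the two strict inequalities force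
    -- all four membership conditions and equal cardinalities. The positivity facts below keep the
    -- subtraction from truncating.
    simp only [Finset.card_erase_eq_ite] at hi
    obtain ⟨h1, h2⟩ := hi
    have p1 : c v ∈ nbrColors G c v → 0 < (nbrColors G c v).card :=
      fun h => Finset.card_pos.2 ⟨_, h⟩
    have p2 : c w ∈ nbrColors G c w → 0 < (nbrColors G c w).card :=
      fun h => Finset.card_pos.2 ⟨_, h⟩
    have p3 : c v ∈ nbrColors G c w → 0 < (nbrColors G c w).card :=
      fun h => Finset.card_pos.2 ⟨_, h⟩
    have p4 : c w ∈ nbrColors G c v → 0 < (nbrColors G c v).card :=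
      fun h => Finset.card_pos.2 ⟨_, h⟩
    split_ifs at h1 h2 <;> first
      | exact ⟨by assumption, by assumption, by assumption, by assumption, by omega⟩
      | omega
  · rintro ⟨h1, h2, h3, h4, h5⟩
    have ha : ¬ G.Adj v w := fun ha => h2 ((mem_nbrColors G c).2 ⟨w, ha, rfl⟩)
    rw [key ha]
    unfold varietyAt
    rw [Finset.card_erase_of_mem h1, Finset.card_erase_of_mem h3, Finset.erase_eq_of_notMem h2,
      Finset.erase_eq_of_notMem h4]
    have p1 : 0 < (nbrColors G c v).card := Finset.card_pos.2 ⟨_, h1⟩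
    omega

/-- By `improves_varietyAt_iff` the swap creates no monochromatic edge and destroys at least one at
`v`. -/
lemma isPotential_varietyAt : IsPotential G (varietyAt G (ι := ι)) := by
  intro c v w hi
  have h := hi.color_ne
  obtain ⟨h1, h2, h3, h4, -⟩ := (improves_varietyAt_iff G c v w).1 hi
  refine sum_numOther_lt_swapColor G c h ?_
  have e1 : countOff G c v w v (c w) = 0 := (countOff_eq_zero G c).2 fun y _ _ hy e =>
    h2 ((mem_nbrColors G c).2 ⟨y, hy, e⟩)
  have e2 : countOff G c v w w (c v) = 0 := (countOff_eq_zero G c).2 fun y _ _ hy e =>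
    h4 ((mem_nbrColors G c).2 ⟨y, hy, e⟩)
  have e3 : 0 < countOff G c v w v (c v) := by
    obtain ⟨y, hy, e⟩ := (mem_nbrColors G c).1 h1
    exact (countOff_pos G c).2 ⟨y, hy.ne', fun e' => h (by rw [← e, e']), hy, e⟩
  omega

end Coloring

/-! ### Translation from assignments of agents to colourings of vertices. -/

section Game

variable {V : Type u} {X : Type v} [Fintype V] [Fintype X] {t : ℕ} (G : SimpleGraph V)
  (typ : X → Fin t)

lemma uDiff_eq (L : X ≃ V) (A : X) :
    uDiff G typ L A = (numOther G (typ ∘ L.symm) (L A) : ℝ) := by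
  classical
  unfold uDiff numOther nbrs
  rw [Nat.cast_inj]
  refine Finset.card_bij' (fun B _ => L B) (fun y _ => L.symm y) ?_ ?_ ?_ ?_ <;> simp

lemma uBinary_eq (L : X ≃ V) (A : X) :
    uBinary G typ L A = (binaryAt G (typ ∘ L.symm) (L A) : ℝ) := by
  classical
  have h : (∃ B ∈ nbrs G L A, typ B ≠ typ A) ↔ 0 < numOther G (typ ∘ L.symm) (L A) := by
    rw [numOther_pos, ← L.exists_congr_right]
    simp [nbrs]
  unfold uBinary binaryAt
  simp only [h]
  push_cast
  rfl

lemma uVariety_eq (L : X ≃ V) (A : X) :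
    uVariety G typ L A = (varietyAt G (typ ∘ L.symm) (L A) : ℝ) := by
  classical
  unfold uVariety varietyAt
  rw [Nat.cast_inj]
  congr 1
  ext i
  simp only [Finset.mem_erase, mem_nbrColors, ← L.exists_congr_right]
  simp [nbrs]

omit [Fintype V] [Fintype X] in
lemma comp_swapped_symm (L : X ≃ V) (A B : X) :
    typ ∘ (swapped L A B).symm = swapColor (typ ∘ L.symm) (L A) (L B) := by
  classical
  funext x
  obtain ⟨C, rfl⟩ := L.surjective x
  have h : (swapped L A B).symm (L C) = Equiv.swap A B C := by simp [swapped]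
  rw [Function.comp_apply, h]
  by_cases h1 : C = A
  · subst h1; rw [swapColor_left]; simp
  by_cases h2 : C = B
  · subst h2; rw [swapColor_right]; simp
  rw [swapColor_of_ne _ (fun e => h1 (L.injective e)) (fun e => h2 (L.injective e)),
    Equiv.swap_apply_of_ne_of_ne h1 h2]
  simp

omit [Fintype V] [Fintype X] in
lemma isEquilibrium_iff {U : (X ≃ V) → X → ℝ} {u : (V → Fin t) → V → ℕ}
    (hU : ∀ L A, U L A = (u (typ ∘ L.symm) (L A) : ℝ)) (L : X ≃ V) :
    IsEquilibrium U L ↔ ∀ v w, ¬ Improves u (typ ∘ L.symm) v w := by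
  classical
  have h : ∀ A B, (U L A < U (swapped L A B) A ∧ U L B < U (swapped L A B) B) ↔
      Improves u (typ ∘ L.symm) (L A) (L B) := fun A B => by
    have e1 : swapped L A B A = L B := by simp [swapped]
    have e2 : swapped L A B B = L A := by simp [swapped]
    simp only [hU, comp_swapped_symm, e1, e2, Nat.cast_lt]
    exact Iff.rfl
  unfold IsEquilibrium
  simp only [h]
  push Not
  exact (L.forall_congr_right (q := fun v => ∀ B, ¬ Improves u (typ ∘ L.symm) v (L B))).trans
    (forall_congr' fun v => L.forall_congr_right (q := fun w => ¬ Improves u (typ ∘ L.symm) v w))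

-- This is the handshake lemma in the subgraph `H` of colourful edges.
omit [Fintype X] in
lemma two_mul_colorfulEdges (L : X ≃ V) :
    2 * colorfulEdges G typ L = ((∑ v, numOther G (typ ∘ L.symm) v : ℕ) : ℝ) := by
  classical
  let H : SimpleGraph V :=
    { Adj := fun v w => G.Adj v w ∧ (typ ∘ L.symm) w ≠ (typ ∘ L.symm) v
      symm := ⟨fun v w h => ⟨h.1.symm, h.2.symm⟩⟩
      loopless := ⟨fun v h => h.2 rfl⟩ }
  have h1 : ({e ∈ G.edgeSet | ¬ (e.map (typ ∘ L.symm)).IsDiag} : Set (Sym2 V)) =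
      (H.edgeFinset : Set (Sym2 V)) := by
    ext e
    induction e with
    | _ v w => simp [H, eq_comm]
  have h2 : ∀ v, H.degree v = numOther G (typ ∘ L.symm) v := fun v => by
    rw [← SimpleGraph.card_neighborFinset_eq_degree]
    unfold numOther
    congr 1
    ext y
    simp [H]
  unfold colorfulEdges
  rw [h1, Set.ncard_coe_finset, ← Finset.sum_congr rfl fun v _ => h2 v,
    H.sum_degrees_eq_twice_card_edges]
  push_cast
  rfl

lemma socialWelfare_uDiff (L : X ≃ V) :
    socialWelfare (uDiff G typ) L = 2 * colorfulEdges G typ L := by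
  rw [two_mul_colorfulEdges]
  unfold socialWelfare
  simp only [uDiff_eq]
  rw [L.sum_comp (fun v => (numOther G (typ ∘ L.symm) v : ℝ))]
  push_cast
  rfl

end Game

/-! ### Lower bounds on the number of colourful neighbours in an equilibrium. -/

section LowerBounds

open Finset

/-- A set on which every pair is related in some direction, by a relation in which every element
points to at most `s` others, has at most `2 s + 1` elements. -/
lemma card_le_two_mul_add_one {α : Type*} [DecidableEq α] (I : Finset α) (h : α → Finset α) (s : ℕ)
    (hs : ∀ i ∈ I, (h i).card ≤ s) (hI : ∀ i ∈ I, ∀ j ∈ I, i ≠ j → j ∈ h i ∨ i ∈ h j) :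
    I.card ≤ 2 * s + 1 := by
  -- Every ordered pair of distinct elements is an arrow or a reversed arrow, so `|I| (|I| - 1) ≤ 2
  -- s |I|`.
  have h1 : I.offDiag ⊆ (I.sigma h).image (fun p => (p.1, p.2)) ∪
      (I.sigma h).image (fun p => (p.2, p.1)) := by
    rintro ⟨i, j⟩ hij
    rw [mem_offDiag] at hij
    obtain ⟨hi, hj, hne⟩ := hij
    simp only [mem_union, mem_image, mem_sigma, Prod.mk.injEq]
    rcases hI i hi j hj hne with h | h
    · exact Or.inl ⟨⟨i, j⟩, ⟨hi, h⟩, rfl, rfl⟩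
    · exact Or.inr ⟨⟨j, i⟩, ⟨hj, h⟩, rfl, rfl⟩
  have h2 : (I.sigma h).card ≤ I.card * s := by
    rw [card_sigma]
    exact sum_le_card_nsmul _ _ _ hs
  have h3 := card_le_card h1
  rw [offDiag_card] at h3
  have h4 := card_union_le ((I.sigma h).image (fun p => (p.1, p.2)))
    ((I.sigma h).image (fun p => (p.2, p.1)))
  have h5 := card_image_le (s := I.sigma h) (f := fun p => (p.1, p.2))
  have h6 := card_image_le (s := I.sigma h) (f := fun p => (p.2, p.1))
  by_contra! hlt
  have h7 : I.card * (2 * s + 2) ≤ I.card * I.card := Nat.mul_le_mul_left _ hlt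
  have h8 : I.card * (2 * s + 2) = 2 * (I.card * s) + 2 * I.card := by ring
  omega

/-- The version of `card_le_two_mul_add_one` for the colours that occur in a set of vertices. -/
lemma card_image_le_two_mul_add_one {V ι : Type*} [DecidableEq ι] (B : Finset V) (c : V → ι)
    (h : V → Finset ι) (s : ℕ) (hs : ∀ v ∈ B, (h v).card ≤ s)
    (hB : ∀ v ∈ B, ∀ w ∈ B, c v ≠ c w → c w ∈ h v ∨ c v ∈ h w) :
    (B.image c).card ≤ 2 * s + 1 := by
  by_cases hne : Nonempty V
  · have hr : ∀ i ∈ B.image c, ∃ v ∈ B, c v = i := fun i hi => mem_image.1 hi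
    choose! r hr using hr
    refine card_le_two_mul_add_one _ (fun i => h (r i)) s (fun i hi => hs _ (hr i hi).1)
      fun i hi j hj hij => ?_
    have := hB (r i) (hr i hi).1 (r j) (hr j hj).1
    rw [(hr i hi).2, (hr j hj).2] at this
    exact this hij
  · rw [not_nonempty_iff] at hne
    simp [Subsingleton.elim B ∅]

variable {V ι : Type*} [Fintype V] (G : SimpleGraph V) {c : V → ι} {s : ℕ}

/-- Every colour is used for at most `s` vertices. -/
def ColorBound (c : V → ι) (s : ℕ) : Prop :=
  ∀ i, (open Classical in univ.filter fun v => c v = i).card ≤ s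

lemma ColorBound.card_le [DecidableEq ι] (hs : ColorBound c s) (B : Finset V) {m : ℕ}
    (hm : (B.image c).card ≤ m) : B.card ≤ m * s := by
  classical
  have := card_le_mul_card_image (f := c) B s fun i _ =>
    (card_le_card (t := univ.filter fun v => c v = i) fun v hv => by
      simp only [mem_filter, mem_univ, true_and] at hv ⊢; exact hv.2).trans
      (le_of_eq_of_le (by congr!) (hs i))
  rw [mul_comm] at this
  exact this.trans (Nat.mul_le_mul_right _ hm)

/-- In an equilibrium all vertices without a neighbour of another colour have the same colour. -/
lemma card_le_sum_numOther_add {u : (V → ι) → V → ℕ} (hu : UnhappySwap G u)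
    (hs : ColorBound c s) (hdeg : ∀ v, 0 < numNbrs G v)
    (heq : ∀ v w, ¬ Improves u c v w) : Fintype.card V ≤ ∑ v, numOther G c v + s := by
  classical
  set B := univ.filter fun v => numOther G c v = 0 with hB
  have h1 : B.card ≤ s := by
    rcases B.eq_empty_or_nonempty with he | ⟨b, hb⟩
    · simp [he]
    · refine (card_le_card fun v hv => ?_).trans (hs (c b))
      simp only [hB, mem_filter, mem_univ, true_and] at hb hv ⊢
      by_contra hne
      exact heq v b (hu c v b hne (hdeg v) (hdeg b) hv hb)
  have h2 : Fintype.card V ≤ ∑ v, numOther G c v + B.card := by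
    rw [hB, card_filter, ← sum_add_distrib, ← card_univ, card_eq_sum_ones]
    exact sum_le_sum fun v _ => by split_ifs <;> omega
  omega

variable {δ : ℕ} (hδ : ∀ v, δ ≤ numNbrs G v) (heq : ∀ v w, ¬ Improves (numOther G) c v w)

lemma numOther_swapColor_add {v w : V} (h : c v ≠ c w) :
    numOther G (swapColor c v w) w + countOff G c v w w (c v) = numNbrs G w := by
  have := colorCount_add_numOther G (swapColor c v w) w
  rw [swapColor_right, colorCount_swapColor_right G c h] at this
  omega

include hδ heq

/-- The neighbours of `w` of the colour of `v` are among the `numOther G c w` foreign ones, so the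
agent from `v` would get at least `δ - numOther G c w` at `w`. If the sum were below `δ`, this and
the symmetric estimate would make the swap improving. -/
lemma le_numOther_add_numOther {v w : V} (h : c v ≠ c w) :
    δ ≤ numOther G c v + numOther G c w := by
  by_contra hlt
  have a1 := numOther_swapColor_add G h
  have a2 := numOther_swapColor_add G h.symm
  have b1 := countOff_le_colorCount G c v w w (c v)
  have b2 := countOff_le_colorCount G c w v v (c w)
  have c1 := colorCount_le_numOther G c h
  have c2 := colorCount_le_numOther G c h.symm
  have d1 := hδ v
  have d2 := hδ w
  refine heq v w ⟨by omega, ?_⟩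
  rw [swapColor_comm]
  omega

/-- Here `v` is itself a neighbour of `w` of the colour `c v`, and it stops being one after the
swap. This sharpens the previous estimate by one. -/
lemma lt_numOther_add_numOther {v w : V} (ha : G.Adj v w) (h : c v ≠ c w) :
    δ < numOther G c v + numOther G c w := by
  by_contra hlt
  have a1 := numOther_swapColor_add G h
  have a2 := numOther_swapColor_add G h.symm
  have b1 := countOff_lt_colorCount G c ha
  have b2 := countOff_lt_colorCount G c ha.symm
  have c1 := colorCount_le_numOther G c h
  have c2 := colorCount_le_numOther G c h.symm
  have d1 := hδ v
  have d2 := hδ w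
  refine heq v w ⟨by omega, ?_⟩
  rw [swapColor_comm]
  omega

/-- Let the minimum `u < δ / 2` be attained at `v`. All vertices outside the colour class of `v`
have at least `δ - u`. With `m` vertices inside the class and `m'` outside, the claim follows from
`11 m ≤ 7 m'`, which is what `18 s ≤ 7 n` provides. -/
lemma le_sum_numOther_of_lt (hs : ColorBound c s) (hsn : 18 * s ≤ 7 * Fintype.card V) {b : V}
    (hb : 2 * numOther G c b < δ) :
    9 * (Fintype.card V * δ) + 2 * Fintype.card V ≤ 18 * ∑ v, numOther G c v := by
  classical
  obtain ⟨v, -, hv⟩ := exists_min_image univ (numOther G c) ⟨b, mem_univ b⟩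
  set u := numOther G c v
  obtain ⟨w, hw⟩ : ∃ w, δ = u + w := ⟨δ - u, by have := hv b (mem_univ b); omega⟩
  have huw : u < w := by have := hv b (mem_univ b); omega
  have h1 : ∑ x : V, (if c x = c v then u else w) ≤ ∑ x, numOther G c x :=
    sum_le_sum fun x _ => by
      split_ifs with h
      · exact hv x (mem_univ x)
      · have := le_numOther_add_numOther G hδ heq (fun e => h e.symm : c v ≠ c x)
        omega
  rw [sum_ite, sum_const, sum_const, smul_eq_mul, smul_eq_mul] at h1
  have h2 := hs (c v)
  have h3 := card_filter_add_card_filter_not (s := (univ : Finset V)) (fun x => c x = c v)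
  rw [card_univ] at h3
  set m := (univ.filter fun x => c x = c v).card
  set m' := (univ.filter fun x => ¬ c x = c v).card
  rw [← h3] at hsn ⊢
  rw [hw]
  obtain ⟨e, rfl⟩ : ∃ e, w = u + 1 + e := ⟨w - u - 1, by omega⟩
  have : 11 * m ≤ 7 * m' := by omega
  nlinarith [Nat.mul_le_mul_right e this]

/-- In an equilibrium for the difference-seeking utility the average utility exceeds half of the
minimum degree by at least `1 / 9`. -/
lemma le_sum_numOther (hδ0 : 1 ≤ δ) (hs : ColorBound c s)
    (hsn : 18 * s ≤ 7 * Fintype.card V) :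
    9 * (Fintype.card V * δ) + 2 * Fintype.card V ≤ 18 * ∑ v, numOther G c v := by
  classical
  by_cases hb : ∃ b, 2 * numOther G c b < δ
  · obtain ⟨b, hb⟩ := hb
    exact le_sum_numOther_of_lt G hδ heq hs hsn hb
  push Not at hb
  set T := univ.filter fun v => 2 * numOther G c v = δ with hT
  set N := univ.filter fun v => ¬ 2 * numOther G c v = δ with hN
  have hTN : T.card + N.card = Fintype.card V := by
    rw [hT, hN, card_filter_add_card_filter_not, card_univ]
  have hsum : ∑ v ∈ T, numOther G c v + ∑ v ∈ N, numOther G c v = ∑ v, numOther G c v :=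
    sum_filter_add_sum_filter_not _ _ _
  have h1 : T.card * δ = 2 * ∑ v ∈ T, numOther G c v := by
    rw [mul_sum, ← smul_eq_mul, ← sum_const]
    exact sum_congr rfl fun v hv => by rw [hT, mem_filter] at hv; exact hv.2.symm
  have h2 : N.card * (δ + 1) ≤ 2 * ∑ v ∈ N, numOther G c v := by
    rw [mul_sum, ← smul_eq_mul, ← sum_const]
    exact sum_le_sum fun v hv => by
      rw [hN, mem_filter] at hv
      have := hb v
      have := hv.2
      omega
  -- The strict inequality for adjacent vertices excludes colourful edges inside `T`, so all
  -- colourful edges at `T` end in `N`.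
  have h3 : ∑ v ∈ T, numOther G c v ≤ ∑ v ∈ N, numOther G c v := by
    have e : ∀ v ∈ T, numOther G c v = ∑ y ∈ N, if G.Adj v y ∧ c y ≠ c v then 1 else 0 := by
      intro v hv
      rw [← card_filter]
      unfold numOther
      rw [hN, filter_filter]
      congr 1
      ext y
      simp only [mem_filter, mem_univ, true_and]
      refine ⟨fun h => ⟨fun hy => ?_, h⟩, fun h => h.2⟩
      have := lt_numOther_add_numOther G hδ heq h.1 h.2.symm
      rw [hT, mem_filter] at hv
      have := hv.2
      omega
    rw [sum_congr rfl e, sum_comm]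
    refine sum_le_sum fun y _ => ?_
    rw [← card_filter]
    refine card_le_card fun v hv => ?_
    simp only [mem_filter, mem_univ, true_and] at hv ⊢
    exact ⟨hv.2.1.symm, hv.2.2.symm⟩
  have h4 : N.card * (δ + 1) = N.card * δ + N.card := by ring
  rw [← hTN, ← hsum, add_mul]
  -- If `N` contains at least `2 / 9` of the vertices, its surplus of `1 / 2` per vertex gives the
  -- extra `n / 9`. Otherwise `T` has more than `7 / 9` of them, and `h3` counts its sum `|T| δ / 2`
  -- twice.
  by_cases h5 : 2 * (T.card + N.card) ≤ 9 * N.card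
  · omega
  · have h6 : 7 * N.card ≤ 2 * T.card := by omega
    have h7 : 7 * (N.card * δ) ≤ 2 * (T.card * δ) := by nlinarith
    have h8 : T.card ≤ T.card * δ := Nat.le_mul_of_pos_right _ hδ0
    omega

/-- In an equilibrium for the difference-seeking utility only a bounded number of colours contain
agents of utility at most `δ - h`. -/
lemma card_numOther_add_le (hs : ColorBound c s) {h : ℕ} (hh : 0 < h) :
    (open Classical in univ.filter fun v => numOther G c v + h ≤ δ).card ≤
      (2 * (δ / h) + 1) * s := by
  classical
  set B := univ.filter fun v => numOther G c v + h ≤ δ with hB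
  -- A vertex of `B` points to the foreign colours occurring at least `h` times around it; it has at
  -- most `δ` foreign neighbours, so there are at most `δ / h` of these. If of two vertices of
  -- different colours neither points to the colour of the other, each agent would get more than `δ
  -- - h` by swapping.
  refine hs.card_le B (card_image_le_two_mul_add_one B c (fun v => (univ.image c).filter fun i =>
    i ≠ c v ∧ h ≤ colorCount G c v i) _ (fun v hv => ?_) fun v hv w hw hne => ?_)
  · rw [hB, mem_filter] at hv
    rw [Nat.le_div_iff_mul_le hh]
    refine le_trans ?_ (Nat.le_of_add_right_le hv.2)
    set H := (univ.image c).filter fun i => i ≠ c v ∧ h ≤ colorCount G c v i with hH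
    have := mul_card_image_le_card_of_maps_to (f := c)
      (s := univ.filter fun y => (G.Adj v y ∧ c y ≠ c v) ∧ c y ∈ H) (t := H)
      (fun y hy => (mem_filter.1 hy).2.2) h fun i hi => by
        have hi' := (mem_filter.1 hi).2
        refine hi'.2.trans (card_le_card fun y hy => ?_)
        simp only [mem_filter, mem_univ, true_and] at hy ⊢
        refine ⟨⟨⟨hy.1, ?_⟩, ?_⟩, hy.2⟩
        · rw [hy.2]; exact hi'.1
        · rw [hy.2]; exact hi
    rw [mul_comm]
    refine this.trans (card_le_card fun y hy => ?_)
    simp only [mem_filter, mem_univ, true_and] at hy ⊢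
    exact hy.1
  · by_contra hcon
    simp only [mem_filter, mem_image, mem_univ, true_and, exists_apply_eq_apply, not_or, not_and,
      not_le] at hcon
    have e1 := hcon.1 hne.symm
    have e2 := hcon.2 hne
    have a1 := numOther_swapColor_add G hne
    have a2 := numOther_swapColor_add G hne.symm
    have b1 := countOff_le_colorCount G c v w w (c v)
    have b2 := countOff_le_colorCount G c w v v (c w)
    have d1 := hδ v
    have d2 := hδ w
    simp only [hB, mem_filter, mem_univ, true_and] at hv hw
    refine heq v w ⟨by omega, ?_⟩
    rw [swapColor_comm]
    omega

omit heq in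
/-- In an equilibrium for the variety-seeking utility at most `r ^ 2` colours contain agents with
fewer than `r` neighbours of other colours. -/
lemma card_numOther_lt_le (heq : ∀ v w, ¬ Improves (varietyAt G) c v w) (hs : ColorBound c s)
    {r : ℕ} (hr : r ≤ δ) :
    (open Classical in univ.filter fun v => numOther G c v < r).card ≤ r ^ 2 * s := by
  classical
  set B := univ.filter fun v => numOther G c v < r with hB
  have hmem : ∀ v ∈ B, c v ∈ nbrColors G c v := fun v hv => by
    rw [hB, mem_filter] at hv
    have h1 := colorCount_add_numOther G c v
    have h2 := hδ v
    have h3 := hv.2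
    have h4 : 0 < colorCount G c v (c v) := by omega
    exact (mem_nbrColors G c).2 ((colorCount_pos G c).1 h4)
  have hcover : B.image c ⊆ (range r).biUnion fun m =>
      (B.filter fun v => varietyAt G c v = m).image c := by
    intro i hi
    obtain ⟨v, hv, rfl⟩ := mem_image.1 hi
    have h1 := varietyAt_le_numOther G c v
    have h2 := (mem_filter.1 hv).2
    exact mem_biUnion.2 ⟨varietyAt G c v, mem_range.2 (by omega),
      mem_image_of_mem _ (mem_filter.2 ⟨hv, rfl⟩)⟩
  have hsum : ∀ r : ℕ, ∑ m ∈ range r, (2 * m + 1) = r ^ 2 := fun r => by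
    induction r with
    | zero => simp
    | succ r ih => rw [sum_range_succ, ih]; ring
  refine hs.card_le B ((card_le_card hcover).trans (card_biUnion_le.trans ?_))
  rw [← hsum]
  -- The vertices of `B` are sorted by the number `m` of foreign colours they see. Each also sees
  -- its own colour, so within a class the sets `nbrColors` have equal size, and by
  -- `improves_varietyAt_iff` one of two differently coloured vertices sees the colour of the other.
  refine sum_le_sum fun m _ => card_image_le_two_mul_add_one _ c
    (fun v => (nbrColors G c v).erase (c v)) m (fun v hv => ?_) fun v hv w hw hne => ?_
  · exact ((mem_filter.1 hv).2).le
  · obtain ⟨hv, ev⟩ := mem_filter.1 hv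
    obtain ⟨hw, ew⟩ := mem_filter.1 hw
    have h := heq v w
    rw [improves_varietyAt_iff] at h
    have e1 : varietyAt G c v + 1 = (nbrColors G c v).card := card_erase_add_one (hmem v hv)
    have e2 : varietyAt G c w + 1 = (nbrColors G c w).card := card_erase_add_one (hmem w hw)
    simp only [mem_erase]
    by_contra hcon
    rw [not_or, not_and, not_and] at hcon
    exact h ⟨hmem v hv, hcon.1 hne.symm, hmem w hw, hcon.2 hne, by omega⟩

end LowerBounds

/-! ### Prices of anarchy and stability from the potential and from lower bounds. -/

section Ratios

variable {V : Type u} {X : Type v} [Fintype V] [Fintype X] {t : ℕ} {G : SimpleGraph V}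
  {typ : X → Fin t}

omit [Fintype V] [Fintype X] in
lemma colorfulEdges_nonneg (L : X ≃ V) : 0 ≤ colorfulEdges G typ L := Nat.cast_nonneg _

omit [Fintype X] in
lemma colorfulEdges_le {Δ : ℕ} (hΔ : ∀ v, numNbrs G v ≤ Δ) (L : X ≃ V) :
    colorfulEdges G typ L ≤ Fintype.card V * Δ / 2 := by
  have h1 := two_mul_colorfulEdges G typ L
  have h2 : ∑ v, numOther G (typ ∘ L.symm) v ≤ Fintype.card V * Δ := by
    rw [← smul_eq_mul, ← Finset.card_univ, ← Finset.sum_const]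
    exact Finset.sum_le_sum fun v _ => (numOther_le_numNbrs G _ v).trans (hΔ v)
  have h3 : ((∑ v, numOther G (typ ∘ L.symm) v : ℕ) : ℝ) ≤ Fintype.card V * Δ := by
    exact_mod_cast h2
  linarith

omit [Fintype X] in
lemma isEquilibrium_of_forall_le {U : (X ≃ V) → X → ℝ} {u : (V → Fin t) → V → ℕ}
    (hU : ∀ L A, U L A = (u (typ ∘ L.symm) (L A) : ℝ)) (hpot : IsPotential G u) {L : X ≃ V}
    (hL : ∀ L', colorfulEdges G typ L' ≤ colorfulEdges G typ L) : IsEquilibrium U L := by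
  rw [isEquilibrium_iff typ hU]
  intro v w hi
  have h1 := hpot _ v w hi
  have h2 := comp_swapped_symm typ L (L.symm v) (L.symm w)
  rw [L.apply_symm_apply, L.apply_symm_apply] at h2
  have h3 := two_mul_colorfulEdges G typ L
  have h4 := two_mul_colorfulEdges G typ (swapped L (L.symm v) (L.symm w))
  rw [h2] at h4
  have h5 := hL (swapped L (L.symm v) (L.symm w))
  have h6 : ((∑ v, numOther G (typ ∘ L.symm) v : ℕ) : ℝ) <
    ((∑ x, numOther G (swapColor (typ ∘ L.symm) v w) x : ℕ) : ℝ) := by exact_mod_cast h1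
  linarith

/-- Some assignment that maximizes the number of colourful edges is an equilibrium. -/
lemma exists_isEquilibrium {U : (X ≃ V) → X → ℝ} {u : (V → Fin t) → V → ℕ}
    (hU : ∀ L A, U L A = (u (typ ∘ L.symm) (L A) : ℝ)) (hpot : IsPotential G u)
    (hc : Fintype.card X = Fintype.card V) :
    ∃ L, IsEquilibrium U L ∧ ∀ L', colorfulEdges G typ L' ≤ colorfulEdges G typ L := by
  have : Nonempty (X ≃ V) := ⟨Fintype.equivOfCardEq hc⟩
  obtain ⟨L, hL⟩ := Finite.exists_max (colorfulEdges G typ : (X ≃ V) → ℝ)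
  exact ⟨L, isEquilibrium_of_forall_le hU hpot hL, hL⟩

/-- A maximizing assignment is an equilibrium, so both suprema agree; `hpos` excludes the quotient
`0 / 0 = 0`. -/
lemma priceOfStability_eq_one {U : (X ≃ V) → X → ℝ} {u : (V → Fin t) → V → ℕ}
    (hU : ∀ L A, U L A = (u (typ ∘ L.symm) (L A) : ℝ)) (hpot : IsPotential G u)
    (hc : Fintype.card X = Fintype.card V)
    (hpos : ∃ L : X ≃ V, 0 < colorfulEdges G typ L) :
    priceOfStability (colorfulEdges G typ) U = 1 := by
  obtain ⟨L, hL, hmax⟩ := exists_isEquilibrium hU hpot hc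
  obtain ⟨L₀, hL₀⟩ := hpos
  have h1 : (⨆ L : X ≃ V, colorfulEdges G typ L) = colorfulEdges G typ L :=
    have : Nonempty (X ≃ V) := ⟨L⟩
    le_antisymm (ciSup_le hmax) (le_ciSup (Set.finite_range _).bddAbove L)
  have h2 : (⨆ L : {L : X ≃ V // IsEquilibrium U L}, colorfulEdges G typ L) =
      colorfulEdges G typ L :=
    have : Nonempty {L : X ≃ V // IsEquilibrium U L} := ⟨⟨L, hL⟩⟩
    le_antisymm (ciSup_le fun L => hmax L) (le_ciSup
      (f := fun L : {L : X ≃ V // IsEquilibrium U L} => colorfulEdges G typ L)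
      (Set.finite_range _).bddAbove ⟨L, hL⟩)
  unfold priceOfStability
  rw [h1, h2]
  exact div_self (hL₀.trans_le (hmax L₀)).ne'

lemma div_two_le_iInf {U : (X ≃ V) → X → ℝ} {u : (V → Fin t) → V → ℕ}
    (hU : ∀ L A, U L A = (u (typ ∘ L.symm) (L A) : ℝ)) (hpot : IsPotential G u)
    (hc : Fintype.card X = Fintype.card V) {m : ℝ}
    (hlow : ∀ L : X ≃ V, (∀ v w, ¬ Improves u (typ ∘ L.symm) v w) →
      m ≤ ((∑ v, numOther G (typ ∘ L.symm) v : ℕ) : ℝ)) :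
    m / 2 ≤ ⨅ L : {L : X ≃ V // IsEquilibrium U L}, colorfulEdges G typ L := by
  obtain ⟨L, hL, -⟩ := exists_isEquilibrium hU hpot hc
  have : Nonempty {L : X ≃ V // IsEquilibrium U L} := ⟨⟨L, hL⟩⟩
  refine le_ciInf fun L => ?_
  have h1 := hlow L ((isEquilibrium_iff typ hU L).1 L.2)
  have h2 := two_mul_colorfulEdges G typ (L : X ≃ V)
  linarith

/-- If the agents of every equilibrium have at least `m` colourful neighbours in total, then
the price of anarchy is at most `n Δ / m`. -/
lemma priceOfAnarchy_le {U : (X ≃ V) → X → ℝ} {u : (V → Fin t) → V → ℕ}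
    (hU : ∀ L A, U L A = (u (typ ∘ L.symm) (L A) : ℝ)) (hpot : IsPotential G u)
    (hc : Fintype.card X = Fintype.card V) {Δ : ℕ} (hΔ : ∀ v, numNbrs G v ≤ Δ) {m : ℝ}
    (hm : 0 < m) (hlow : ∀ L : X ≃ V, (∀ v w, ¬ Improves u (typ ∘ L.symm) v w) →
      m ≤ ((∑ v, numOther G (typ ∘ L.symm) v : ℕ) : ℝ)) :
    priceOfAnarchy (colorfulEdges G typ) U ≤ Fintype.card V * Δ / m := by
  have : Nonempty (X ≃ V) := ⟨Fintype.equivOfCardEq hc⟩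
  have h1 : (⨆ L : X ≃ V, colorfulEdges G typ L) ≤ Fintype.card V * Δ / 2 :=
    ciSup_le (colorfulEdges_le hΔ)
  have h2 := div_two_le_iInf hU hpot hc hlow
  have h3 : (Fintype.card V * Δ / m : ℝ) = (Fintype.card V * Δ / 2) / (m / 2) := by
    field_simp
  rw [h3]
  unfold priceOfAnarchy
  gcongr

lemma one_le_priceOfAnarchy {U : (X ≃ V) → X → ℝ} {u : (V → Fin t) → V → ℕ}
    (hU : ∀ L A, U L A = (u (typ ∘ L.symm) (L A) : ℝ)) (hpot : IsPotential G u)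
    (hc : Fintype.card X = Fintype.card V) {m : ℝ}
    (hm : 0 < m) (hlow : ∀ L : X ≃ V, (∀ v w, ¬ Improves u (typ ∘ L.symm) v w) →
      m ≤ ((∑ v, numOther G (typ ∘ L.symm) v : ℕ) : ℝ)) :
    1 ≤ priceOfAnarchy (colorfulEdges G typ) U := by
  have h2 := div_two_le_iInf hU hpot hc hlow
  obtain ⟨L, hL, -⟩ := exists_isEquilibrium hU hpot hc
  unfold priceOfAnarchy
  rw [one_le_div (by linarith)]
  exact (ciInf_le (f := fun L : {L : X ≃ V // IsEquilibrium U L} => colorfulEdges G typ L)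
    (Set.finite_range _).bddBelow ⟨L, hL⟩).trans (le_ciSup (Set.finite_range _).bddAbove L)

/-- Social welfare is twice the number of colourful edges, and the factor 2 cancels. -/
lemma priceOfAnarchy_socialWelfare_uDiff {U : (X ≃ V) → X → ℝ} :
    priceOfAnarchy (colorfulEdges G typ) U =
      priceOfAnarchy (socialWelfare (uDiff G typ)) U := by
  unfold priceOfAnarchy
  simp only [socialWelfare_uDiff]
  rw [← Real.mul_iSup_of_nonneg two_pos.le, ← Real.mul_iInf_of_nonneg two_pos.le,
    mul_div_mul_left _ _ two_ne_zero]

end Ratios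

/-! ### Consequences of connectedness and of equitable types. -/

section Setting

variable {V : Type u} {X : Type v} [Fintype V] [Fintype X] {t : ℕ} {G : SimpleGraph V}
  {typ : X → Fin t}

lemma colorBound_of_forall_card_le {s : ℕ}
    (h : ∀ i, (Finset.univ.filter fun A => typ A = i).card ≤ s) (L : X ≃ V) :
    ColorBound (typ ∘ L.symm) s := by
  classical
  intro i
  refine le_trans (le_of_eq ?_) (h i)
  refine Finset.card_bij' (fun y _ => L.symm y) (fun A _ => L A) ?_ ?_ ?_ ?_ <;> simp

lemma Setting.colorBound (h : Setting G typ) (L : X ≃ V) :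
    ColorBound (typ ∘ L.symm) (Fintype.card V / t + 1) :=
  colorBound_of_forall_card_le (fun i => by have := h.equitable.card_type i; omega) L

lemma Setting.numNbrs_pos (h : Setting G typ) (hn : 2 ≤ Fintype.card V) (v : V) :
    0 < numNbrs G v := by
  have : Nontrivial V := Fintype.one_lt_card_iff_nontrivial.1 hn
  exact (SwapGame.numNbrs_pos G).2 (h.connected.preconnected.exists_adj_of_nontrivial v)

lemma numNbrs_eq_degree [DecidableRel G.Adj] (v : V) : numNbrs G v = G.degree v := by
  classical
  rw [← SimpleGraph.card_neighborFinset_eq_degree]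
  unfold numNbrs
  congr 1
  ext y
  simp

lemma numNbrs_le_maxDegree [DecidableRel G.Adj] (v : V) : numNbrs G v ≤ G.maxDegree := by
  rw [numNbrs_eq_degree]
  exact G.degree_le_maxDegree v

lemma minDegree_le_numNbrs [DecidableRel G.Adj] (v : V) : G.minDegree ≤ numNbrs G v := by
  rw [numNbrs_eq_degree]
  exact G.minDegree_le_degree v

lemma Setting.minDegree_pos [DecidableRel G.Adj] (h : Setting G typ)
    (hn : 2 ≤ Fintype.card V) : 0 < G.minDegree := by
  have : Nonempty V := h.connected.nonempty
  obtain ⟨v, hv⟩ := G.exists_minimal_degree_vertex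
  rw [hv, ← numNbrs_eq_degree]
  exact h.numNbrs_pos hn v

/-- Without a colourful edge the connected graph would be monochromatic, so `n ≤ n / t + 1 ≤ n / 3 +
1`, which fails for `n ≥ 2`. -/
lemma Setting.colorfulEdges_pos (h : Setting G typ) (hn : 2 ≤ Fintype.card V) (L : X ≃ V) :
    0 < colorfulEdges G typ L := by
  have h3 := h.three_le
  by_contra hcon
  have h0 : colorfulEdges G typ L = 0 := le_antisymm (not_lt.1 hcon) (colorfulEdges_nonneg L)
  have h2 := two_mul_colorfulEdges G typ L
  rw [h0, mul_zero] at h2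
  have hz : ∀ v, numOther G (typ ∘ L.symm) v = 0 := fun v => by
    have h5 : ∑ v, numOther G (typ ∘ L.symm) v = 0 := by exact_mod_cast h2.symm
    exact (Finset.sum_eq_zero_iff.1 h5) v (Finset.mem_univ v)
  have hw : ∀ v w, G.Reachable v w → (typ ∘ L.symm) v = (typ ∘ L.symm) w := by
    rintro v w ⟨p⟩
    induction p with
    | nil => rfl
    | cons ha _ ih =>
      refine Eq.trans ?_ ih
      by_contra hne
      exact not_adj_of_numOther_eq_zero G hne (hz _) ha
  have hcard : Fintype.card V ≤ Fintype.card V / t + 1 := by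
    obtain ⟨v⟩ := h.connected.nonempty
    have h6 := h.colorBound L ((typ ∘ L.symm) v)
    refine (Finset.card_le_card fun w _ => ?_).trans h6
    simp only [Finset.mem_filter, Finset.mem_univ, true_and]
    exact hw w v (h.connected.preconnected w v)
  have : Fintype.card V / t ≤ Fintype.card V / 3 := Nat.div_le_div_left h3 (by norm_num)
  omega

end Setting

/-! ### Averages in an equilibrium outside a small exceptional set. -/

section Bounds

lemma sub_mul_le_sum {V : Type*} [Fintype V] (f : V → ℕ) (B : Finset V) {r β : ℝ}
    (hβ : (B.card : ℝ) ≤ β) (hr : 0 ≤ r) (h : ∀ v, v ∉ B → r ≤ f v) :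
    (Fintype.card V - β) * r ≤ ((∑ v, f v : ℕ) : ℝ) := by
  classical
  have h1 : ∑ v ∈ Bᶜ, r ≤ ∑ v ∈ Bᶜ, (f v : ℝ) :=
    Finset.sum_le_sum fun v hv => h v (Finset.mem_compl.1 hv)
  have h2 : ∑ v ∈ Bᶜ, (f v : ℝ) ≤ ∑ v, (f v : ℝ) :=
    Finset.sum_le_sum_of_subset_of_nonneg (Finset.subset_univ _) fun _ _ _ => by positivity
  rw [Finset.sum_const, nsmul_eq_mul, Finset.card_compl, Nat.cast_sub (Finset.card_le_univ B)] at h1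
  push_cast
  refine le_trans ?_ (h1.trans h2)
  gcongr

variable {V : Type*} [Fintype V] {G : SimpleGraph V} {t k δ : ℕ} {c : V → Fin t}

/-- If there are many types, then the average number of colourful neighbours in an equilibrium for
the difference-seeking utility is close to the minimum degree. -/
lemma le_sum_numOther_of_many_types {η : ℝ} (hη : 0 < η) (hη1 : η < 1)
    (hs : ColorBound c (k + 1)) (hk : 1 ≤ k) (hn : t * k ≤ Fintype.card V) (hδ0 : 1 ≤ δ)
    (hδ : ∀ v, δ ≤ numNbrs G v) (heq : ∀ v w, ¬ Improves (numOther G) c v w)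
    (ht : 2 * (2 * ⌊1 / η⌋₊ + 1) / η ≤ (t : ℝ)) :
    (1 - η) ^ 2 * (Fintype.card V * δ) ≤ ((∑ v, numOther G c v : ℕ) : ℝ) := by
  classical
  have hδ' : (1 : ℝ) ≤ δ := by exact_mod_cast hδ0
  have hpos : 0 < η * δ := by positivity
  have hh : 0 < ⌈η * δ⌉₊ := Nat.ceil_pos.2 hpos
  have h1 := card_numOther_add_le G hδ heq hs hh
  have h2 : δ / ⌈η * δ⌉₊ ≤ ⌊1 / η⌋₊ := by
    refine Nat.le_floor (Nat.cast_div_le.trans ?_)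
    rw [div_le_div_iff₀ (by exact_mod_cast hh) hη, one_mul, mul_comm]
    exact Nat.le_ceil _
  have h3 : (2 * (δ / ⌈η * δ⌉₊) + 1) * (k + 1) ≤ (2 * ⌊1 / η⌋₊ + 1) * (2 * k) := by
    gcongr
    omega
  have h4 := h1.trans h3
  set B := Finset.univ.filter fun v => numOther G c v + ⌈η * δ⌉₊ ≤ δ with hB
  have h5 : (B.card : ℝ) ≤ (2 * ⌊1 / η⌋₊ + 1) * (2 * k) := by
    refine le_trans ?_ (show (((2 * ⌊1 / η⌋₊ + 1) * (2 * k) : ℕ) : ℝ) ≤ _ by push_cast; rfl)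
    exact_mod_cast h4
  have h6 : (B.card : ℝ) ≤ η * Fintype.card V := by
    rw [div_le_iff₀ hη] at ht
    have h7 : (t * k : ℝ) ≤ Fintype.card V := by exact_mod_cast hn
    calc (B.card : ℝ) ≤ (2 * (2 * ⌊1 / η⌋₊ + 1)) * k := by linarith
      _ ≤ (t * η) * k := by gcongr
      _ = η * (t * k) := by ring
      _ ≤ _ := by gcongr
  -- Outside `B` there are at least `δ + 1 - ⌈η δ⌉` colourful neighbours; the `+ 1` absorbs the
  -- rounding.
  have h7 := sub_mul_le_sum (numOther G c) B (r := (1 - η) * δ) h6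
    (mul_nonneg (by linarith) (by positivity)) fun v hv => by
      simp only [hB, Finset.mem_filter, Finset.mem_univ, true_and, not_le] at hv
      have a1 : ((δ + 1 : ℕ) : ℝ) ≤ ((numOther G c v + ⌈η * δ⌉₊ : ℕ) : ℝ) := by exact_mod_cast hv
      have a2 := Nat.ceil_lt_add_one hpos.le
      push_cast at a1
      linarith
  linarith

/-- If `r ≤ δ`, then all but `r ^ 2 (k + 1)` agents of an equilibrium for the variety-seeking
utility have at least `r` colourful neighbours. -/
lemma mul_le_sum_numOther_of_varietyAt {β : ℝ} {r : ℕ} (hr : r ≤ δ)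
    (hs : ColorBound c (k + 1)) (hk : 1 ≤ k)
    (hδ : ∀ v, δ ≤ numNbrs G v) (heq : ∀ v w, ¬ Improves (varietyAt G) c v w)
    (hβ : 2 * (r : ℝ) ^ 2 * k ≤ β) :
    (Fintype.card V - β) * r ≤ ((∑ v, numOther G c v : ℕ) : ℝ) := by
  classical
  have h1 := card_numOther_lt_le G hδ heq hs hr
  have h2 : r ^ 2 * (k + 1) ≤ 2 * r ^ 2 * k := by nlinarith [Nat.zero_le (r ^ 2)]
  refine sub_mul_le_sum _ (Finset.univ.filter fun v => numOther G c v < r) (le_trans ?_ hβ)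
    (by positivity) fun v hv => ?_
  · exact_mod_cast h1.trans h2
  · simp only [Finset.mem_filter, Finset.mem_univ, true_and, not_lt] at hv
    exact_mod_cast hv

end Bounds

/-! ### The upper bounds on the price of anarchy. -/

section Main

variable {V : Type u} {X : Type v} [Fintype V] [Fintype X] {t : ℕ} {G : SimpleGraph V}
  {typ : X → Fin t}

lemma Setting.mul_div_le (h : Setting G typ) :
    (3 * (Fintype.card V / t) ≤ Fintype.card V) ∧
      (t : ℝ) * ((Fintype.card V / t : ℕ) : ℝ) ≤ Fintype.card V := by
  have h1 := Nat.mul_div_le (Fintype.card V) t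
  exact ⟨(Nat.mul_le_mul_right _ h.three_le).trans h1, by exact_mod_cast h1⟩

lemma Setting.le_sum_numOther_of_unhappySwap (h : Setting G typ) {u : (V → Fin t) → V → ℕ}
    (hu : UnhappySwap G u) (hk : 1 ≤ Fintype.card V / t) (L : X ≃ V)
    (heq : ∀ v w, ¬ Improves u (typ ∘ L.symm) v w) :
    (Fintype.card V : ℝ) - (((Fintype.card V / t : ℕ) : ℝ) + 1) ≤
      ((∑ v, numOther G (typ ∘ L.symm) v : ℕ) : ℝ) := by
  have h1 := card_le_sum_numOther_add G hu (h.colorBound L)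
    (h.numNbrs_pos (by have := h.mul_div_le.1; omega)) heq
  have h2 : (Fintype.card V : ℝ) ≤ ((∑ v, numOther G (typ ∘ L.symm) v : ℕ) : ℝ) +
    (((Fintype.card V / t : ℕ) : ℝ) + 1) := by exact_mod_cast h1
  linarith

lemma Setting.priceOfAnarchy_le_of_unhappySwap [DecidableRel G.Adj] (h : Setting G typ)
    {U : (X ≃ V) → X → ℝ} {u : (V → Fin t) → V → ℕ}
    (hU : ∀ L A, U L A = (u (typ ∘ L.symm) (L A) : ℝ)) (hpot : IsPotential G u)
    (hu : UnhappySwap G u) {ε : ℝ} (hε : 0 < ε)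
    (hk : 1 + (1 + ε) / (2 * ε) ≤ ((Fintype.card V / t : ℕ) : ℝ)) :
    priceOfAnarchy (colorfulEdges G typ) U ≤
      (1 + ε) * ((G.maxDegree : ℝ) * t / ((t : ℝ) - 1)) := by
  have hk1 : 1 ≤ Fintype.card V / t := by
    have : (0 : ℝ) ≤ (1 + ε) / (2 * ε) := by positivity
    have : (1 : ℝ) ≤ ((Fintype.card V / t : ℕ) : ℝ) := by linarith
    exact_mod_cast this
  obtain ⟨h3, hn⟩ := h.mul_div_le
  have h3' : 3 * ((Fintype.card V / t : ℕ) : ℝ) ≤ Fintype.card V := by exact_mod_cast h3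
  have hk1' : (1 : ℝ) ≤ ((Fintype.card V / t : ℕ) : ℝ) := by exact_mod_cast hk1
  have ht : (3 : ℝ) ≤ t := by exact_mod_cast h.three_le
  have hlow := h.le_sum_numOther_of_unhappySwap hu hk1
  set n : ℝ := (Fintype.card V : ℝ)
  set k : ℝ := ((Fintype.card V / t : ℕ) : ℝ)
  have hm : 0 < n - (k + 1) := by linarith
  refine (priceOfAnarchy_le hU hpot h.equitable.card_eq numNbrs_le_maxDegree hm hlow).trans ?_
  have hk2 : 1 + ε ≤ 2 * ε * k := by
    have : (1 + ε) / (2 * ε) ≤ k := by linarith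
    rwa [div_le_iff₀ (by positivity), mul_comm] at this
  -- After using `t k ≤ n`, this amounts to `1 + ε ≤ (t - 1) ε k`, and `t - 1 ≥ 2` reduces it to
  -- `hk2`.
  have key : n * (t - 1) ≤ (1 + ε) * t * (n - (k + 1)) := by
    have e1 : t * k * (1 + ε * t) ≤ n * (1 + ε * t) := by gcongr
    have e2 : 2 * (ε * k) ≤ (t - 1) * (ε * k) := by gcongr; linarith
    have e3 : t * (1 + ε) ≤ t * ((t - 1) * (ε * k)) := by gcongr; linarith
    linarith
  rw [← mul_div_assoc, div_le_div_iff₀ hm (by linarith)]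
  have e0 : (0 : ℝ) ≤ G.maxDegree := by positivity
  nlinarith [mul_le_mul_of_nonneg_left key e0]

variable [DecidableRel G.Adj]

/-- The bound 6 on `k` comes from `18 (k + 1) ≤ 21 k ≤ 7 n`, where `n ≥ 3 k`. -/
lemma Setting.le_sum_numOther (h : Setting G typ) (hk : 6 ≤ Fintype.card V / t) (L : X ≃ V)
    (heq : ∀ v w, ¬ Improves (numOther G) (typ ∘ L.symm) v w) :
    (Fintype.card V : ℝ) * G.minDegree / 2 + (Fintype.card V : ℝ) / 9 ≤
      ((∑ v, numOther G (typ ∘ L.symm) v : ℕ) : ℝ) := by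
  have h3 := h.mul_div_le.1
  have h1 := SwapGame.le_sum_numOther G minDegree_le_numNbrs heq (h.minDegree_pos (by omega))
    (h.colorBound L) (by omega)
  have h2 : 9 * ((Fintype.card V : ℝ) * G.minDegree) + 2 * Fintype.card V ≤
      18 * ((∑ v, numOther G (typ ∘ L.symm) v : ℕ) : ℝ) := by exact_mod_cast h1
  linarith

lemma Setting.priceOfAnarchy_uDiff_le (h : Setting G typ) {ε : ℝ} (hε : 0 < ε)
    (hk : 6 ≤ Fintype.card V / t) :
    priceOfAnarchy (colorfulEdges G typ) (uDiff G typ) ≤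
      (1 + ε) * (2 * (G.maxDegree : ℝ) / G.minDegree) := by
  have h3 := h.mul_div_le.1
  have hn : (0 : ℝ) < Fintype.card V := by
    have : 0 < Fintype.card V := by omega
    exact_mod_cast this
  have hδ : (0 : ℝ) < G.minDegree := by exact_mod_cast h.minDegree_pos (by omega)
  refine (priceOfAnarchy_le (uDiff_eq G typ) (isPotential_numOther G) h.equitable.card_eq
    numNbrs_le_maxDegree (m := Fintype.card V * G.minDegree / 2) (by positivity)
    fun L hL => ?_).trans ?_
  · have := h.le_sum_numOther hk L hL
    linarith [div_pos hn (by norm_num : (0 : ℝ) < 9)]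
  · have e : (Fintype.card V * G.maxDegree / (Fintype.card V * G.minDegree / 2) : ℝ) =
        2 * G.maxDegree / G.minDegree := by field_simp
    rw [e]
    exact le_mul_of_one_le_left (by positivity) (by linarith)

omit [DecidableRel G.Adj] in
lemma exists_le_sum_numOther_of_many_types {η : ℝ} (hη : 0 < η) (hη1 : η < 1) :
    ∃ T : ℝ, 0 < T ∧ ∀ (V : Type u) (X : Type v) [Fintype V] [Fintype X] (t : ℕ)
      (G : SimpleGraph V) [DecidableRel G.Adj] (typ : X → Fin t), SwapGame.Setting G typ →
      1 ≤ Fintype.card V / t → T ≤ (t : ℝ) → ∀ L : X ≃ V,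
      (∀ v w, ¬ Improves (numOther G) (typ ∘ L.symm) v w) →
      (1 - η) ^ 2 * (Fintype.card V * G.minDegree) ≤
        ((∑ v, numOther G (typ ∘ L.symm) v : ℕ) : ℝ) := by
  refine ⟨2 * (2 * ⌊1 / η⌋₊ + 1) / η, by positivity, ?_⟩
  intro V X _ _ t G _ typ h hk ht L hL
  have h3 := h.mul_div_le.1
  exact SwapGame.le_sum_numOther_of_many_types hη hη1 (h.colorBound L) hk
    (Nat.mul_div_le _ _) (h.minDegree_pos (by omega)) minDegree_le_numNbrs hL ht

omit [DecidableRel G.Adj] in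
lemma uDiff_many_types {ε : ℝ} (hε : 0 < ε) :
    ∃ (C : ℝ) (K : ℕ),
      ∀ (V : Type u) (X : Type v) [Fintype V] [Fintype X] (t : ℕ) (G : SimpleGraph V)
        [DecidableRel G.Adj] (typ : X → Fin t), SwapGame.Setting G typ →
        K ≤ Fintype.card V / t →
        C * (1 + (G.minDegree : ℝ) * Real.log G.minDegree) ≤ (t : ℝ) →
        1 ≤ priceOfAnarchy (colorfulEdges G typ) (uDiff G typ) ∧
        priceOfAnarchy (colorfulEdges G typ) (uDiff G typ) ≤
          (1 + ε) * ((G.maxDegree : ℝ) / G.minDegree) := by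
  -- This choice makes `1 - 2 η = 1 / (1 + ε)`, and `(1 - η) ^ 2 ≥ 1 - 2 η`.
  set η : ℝ := ε / (2 * (1 + ε)) with hη
  have hη0 : 0 < η := by positivity
  have hη2 : 2 * η * (1 + ε) = ε := by rw [hη]; field_simp
  have hη1 : η < 1 := by
    rw [hη, div_lt_one (by positivity)]; linarith
  have hη3 : 1 ≤ (1 + ε) * (1 - η) ^ 2 := by nlinarith [sq_nonneg η]
  obtain ⟨T, hT, hlow⟩ := exists_le_sum_numOther_of_many_types.{u, v} hη0 hη1
  -- The factor `1 + δ log δ` is at least 1, so `C = T` already forces `T ≤ t`.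
  refine ⟨T, 1, ?_⟩
  intro V X _ _ t G _ typ h hk ht
  have h3 := h.mul_div_le.1
  have hn : (0 : ℝ) < Fintype.card V := by
    have : 0 < Fintype.card V := by omega
    exact_mod_cast this
  have hδ : (1 : ℝ) ≤ G.minDegree := by exact_mod_cast h.minDegree_pos (by omega)
  have hT' : T ≤ t := by
    refine le_trans (le_mul_of_one_le_right hT.le ?_) ht
    have := mul_nonneg (by linarith : (0 : ℝ) ≤ G.minDegree) (Real.log_nonneg hδ)
    linarith
  have hsq : 0 < (1 - η) ^ 2 := by
    have : 0 < 1 - η := by linarith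
    positivity
  have hm : 0 < (1 - η) ^ 2 * (Fintype.card V * G.minDegree : ℝ) := by positivity
  refine ⟨one_le_priceOfAnarchy (uDiff_eq G typ) (isPotential_numOther G) h.equitable.card_eq hm
    (hlow V X t G typ h hk hT'), (priceOfAnarchy_le (uDiff_eq G typ) (isPotential_numOther G)
    h.equitable.card_eq numNbrs_le_maxDegree hm (hlow V X t G typ h hk hT')).trans ?_⟩
  rw [← mul_div_assoc, div_le_div_iff₀ hm (by linarith)]
  calc (Fintype.card V * G.maxDegree * G.minDegree : ℝ)
      = 1 * (Fintype.card V * G.maxDegree * G.minDegree) := by ring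
    _ ≤ ((1 + ε) * (1 - η) ^ 2) * (Fintype.card V * G.maxDegree * G.minDegree) := by gcongr
    _ = _ := by ring

omit [DecidableRel G.Adj] in
lemma uDiff_medium_types {b : ℝ} (hb : 0 < b) :
    ∃ c : ℝ, 0 < c ∧ ∀ ε : ℝ, 0 < ε → ∃ K : ℕ,
      ∀ (V : Type u) (X : Type v) [Fintype V] [Fintype X] (t : ℕ) (G : SimpleGraph V)
        [DecidableRel G.Adj] (typ : X → Fin t), SwapGame.Setting G typ →
        K ≤ Fintype.card V / t → (t : ℝ) ≤ b * G.minDegree →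
        priceOfAnarchy (colorfulEdges G typ) (uDiff G typ) ≤
          (1 + ε) * (2 / ((G.minDegree : ℝ) / G.maxDegree +
            c * ((t : ℝ) ^ 2 / ((G.minDegree : ℝ) * G.maxDegree) - 1 / (G.maxDegree : ℝ)))) := by
  obtain ⟨T, hT, hlow⟩ := exists_le_sum_numOther_of_many_types.{u, v}
    (show (0 : ℝ) < 1 / 4 by norm_num) (by norm_num)
  -- The bound `1 / 2` keeps the denominator positive, `2 / 9` serves the case `t < T`, and `1 / 8`
  -- the case `T ≤ t`.
  obtain ⟨c, hc, hc1, hcT, hcb⟩ : ∃ c : ℝ, 0 < c ∧ c ≤ 1 / 2 ∧ c * T ^ 2 ≤ 2 / 9 ∧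
      c * b ^ 2 ≤ 1 / 8 := by
    refine ⟨min (1 / 2) (min (2 / 9 / T ^ 2) (1 / 8 / b ^ 2)), by positivity, min_le_left _ _,
      ?_, ?_⟩
    · rw [← le_div_iff₀ (by positivity)]
      exact (min_le_right _ _).trans (min_le_left _ _)
    · rw [← le_div_iff₀ (by positivity)]
      exact (min_le_right _ _).trans (min_le_right _ _)
  refine ⟨c, hc, fun ε hε => ⟨6, ?_⟩⟩
  intro V X _ _ t G _ typ h hk ht
  have h3 := h.mul_div_le.1
  have hn : (0 : ℝ) < Fintype.card V := by
    have : 0 < Fintype.card V := by omega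
    exact_mod_cast this
  have hδ : (1 : ℝ) ≤ G.minDegree := by exact_mod_cast h.minDegree_pos (by omega)
  have hΔ : (1 : ℝ) ≤ G.maxDegree := hδ.trans (by exact_mod_cast G.minDegree_le_maxDegree)
  have hlow₁ := h.le_sum_numOther hk
  have hlow₂ := hlow V X t G typ h (by omega)
  set n : ℝ := (Fintype.card V : ℝ)
  set δ : ℝ := (G.minDegree : ℝ)
  set Δ : ℝ := (G.maxDegree : ℝ)
  have ht0 : (0 : ℝ) ≤ t := by positivity
  have hpos : 0 < δ ^ 2 + c * (t ^ 2 - δ) := by nlinarith [mul_nonneg hc.le (sq_nonneg (t : ℝ))]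
  have hm : 0 < n * (δ ^ 2 + c * (t ^ 2 - δ)) / (2 * δ) := by positivity
  refine (priceOfAnarchy_le (uDiff_eq G typ) (isPotential_numOther G) h.equitable.card_eq
    numNbrs_le_maxDegree hm fun L hL => ?_).trans ?_
  · have hd : c * (t ^ 2 - δ) ≤ c * t ^ 2 := by
      have : 0 ≤ c * δ := by positivity
      linarith
    rw [div_le_iff₀ (by positivity)]
    -- For `T ≤ t` the average is at least `(3 / 4) ^ 2 δ = (δ / 2) (1 + 1 / 8)`, and `c t ^ 2 ≤ δ ^
    -- 2 / 8` since `t ≤ b δ`. For `t < T` the surplus `1 / 9` over `δ / 2` is enough, because `c t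
    -- ^ 2` is bounded.
    rcases le_or_gt T t with hTt | hTt
    · refine le_trans ?_ (mul_le_mul_of_nonneg_right (hlow₂ hTt L hL) (by positivity))
      have e1 : c * t ^ 2 ≤ δ ^ 2 / 8 := by
        calc c * t ^ 2 ≤ c * (b * δ) ^ 2 := by gcongr
          _ = (c * b ^ 2) * δ ^ 2 := by ring
          _ ≤ (1 / 8) * δ ^ 2 := by gcongr
          _ = _ := by ring
      have e2 : n * (δ ^ 2 + c * (t ^ 2 - δ)) ≤ n * (δ ^ 2 + δ ^ 2 / 8) :=
        mul_le_mul_of_nonneg_left (by linarith) hn.le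
      linarith
    · refine le_trans ?_ (mul_le_mul_of_nonneg_right (hlow₁ L hL) (by positivity))
      have e1 : c * t ^ 2 ≤ 2 / 9 * δ := by
        calc c * t ^ 2 ≤ c * T ^ 2 := by gcongr
          _ ≤ 2 / 9 := hcT
          _ ≤ _ := by linarith
      have e2 : n * (δ ^ 2 + c * (t ^ 2 - δ)) ≤ n * (δ ^ 2 + 2 / 9 * δ) :=
        mul_le_mul_of_nonneg_left (by linarith) hn.le
      linarith
  · have e : n * Δ / (n * (δ ^ 2 + c * (t ^ 2 - δ)) / (2 * δ)) =
        2 / (δ / Δ + c * (t ^ 2 / (δ * Δ) - 1 / Δ)) := by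
      have e1 : δ / Δ + c * (t ^ 2 / (δ * Δ) - 1 / Δ) = (δ ^ 2 + c * (t ^ 2 - δ)) / (δ * Δ) := by
        field_simp
      rw [e1]
      have := hpos.ne'
      field_simp
    have e0 : 0 ≤ n * Δ / (n * (δ ^ 2 + c * (t ^ 2 - δ)) / (2 * δ)) := by positivity
    rw [← e]
    exact le_mul_of_one_le_left e0 (by linarith)

omit [DecidableRel G.Adj] in
lemma uVariety_many_types {ε : ℝ} (hε : 0 < ε) :
    ∃ (C : ℝ) (K : ℕ),
      ∀ (V : Type u) (X : Type v) [Fintype V] [Fintype X] (t : ℕ) (G : SimpleGraph V)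
        [DecidableRel G.Adj] (typ : X → Fin t), SwapGame.Setting G typ →
        K ≤ Fintype.card V / t →
        C * (G.minDegree : ℝ) ^ 3 ≤ (t : ℝ) →
        1 ≤ priceOfAnarchy (colorfulEdges G typ) (uVariety G typ) ∧
        priceOfAnarchy (colorfulEdges G typ) (uVariety G typ) ≤
          (1 + ε) * ((G.maxDegree : ℝ) / G.minDegree) := by
  -- With `r = δ` there are at most `2 δ ^ 2 k` exceptional vertices. This constant makes them at
  -- most the fraction `ε / (1 + ε)` of all vertices, which leaves `n / (1 + ε)`.
  refine ⟨2 * ((1 + ε) / ε), 1, ?_⟩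
  intro V X _ _ t G _ typ h hk ht
  obtain ⟨h3, hn'⟩ := h.mul_div_le
  have hn : (0 : ℝ) < Fintype.card V := by
    have : 0 < Fintype.card V := by omega
    exact_mod_cast this
  have hδ : (1 : ℝ) ≤ G.minDegree := by exact_mod_cast h.minDegree_pos (by omega)
  have hm : 0 < (Fintype.card V - ε / (1 + ε) * Fintype.card V : ℝ) * G.minDegree := by
    have e : (Fintype.card V - ε / (1 + ε) * Fintype.card V : ℝ) =
      Fintype.card V / (1 + ε) := by field_simp; ring
    rw [e]
    positivity
  have hlow : ∀ L : X ≃ V, (∀ v w, ¬ Improves (varietyAt G) (typ ∘ L.symm) v w) →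
      (Fintype.card V - ε / (1 + ε) * Fintype.card V : ℝ) * G.minDegree ≤
        ((∑ v, numOther G (typ ∘ L.symm) v : ℕ) : ℝ) := fun L hL => by
    refine mul_le_sum_numOther_of_varietyAt le_rfl (h.colorBound L) hk
      minDegree_le_numNbrs hL ?_
    set k : ℝ := ((Fintype.card V / t : ℕ) : ℝ)
    have hk0 : 0 ≤ k := by positivity
    have e1 : (G.minDegree : ℝ) ^ 2 ≤ (G.minDegree : ℝ) ^ 3 := pow_le_pow_right₀ hδ (by norm_num)
    rw [div_mul_eq_mul_div, le_div_iff₀ (by positivity)]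
    calc 2 * (G.minDegree : ℝ) ^ 2 * k * (1 + ε)
        ≤ 2 * (G.minDegree : ℝ) ^ 3 * k * (1 + ε) := by gcongr
      _ = ε * ((2 * ((1 + ε) / ε) * (G.minDegree : ℝ) ^ 3) * k) := by field_simp
      _ ≤ ε * (t * k) := by gcongr
      _ ≤ _ := by gcongr
  refine ⟨one_le_priceOfAnarchy (uVariety_eq G typ) (isPotential_varietyAt G) h.equitable.card_eq
    hm hlow, (priceOfAnarchy_le (uVariety_eq G typ) (isPotential_varietyAt G)
    h.equitable.card_eq numNbrs_le_maxDegree hm hlow).trans (le_of_eq ?_)⟩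
  have e : (Fintype.card V - ε / (1 + ε) * Fintype.card V : ℝ) =
      Fintype.card V / (1 + ε) := by field_simp; ring
  rw [e]
  field_simp

omit [DecidableRel G.Adj] in
lemma uVariety_few_types {b : ℝ} (hb : 0 < b) :
    ∃ C : ℝ, 0 < C ∧
      ∀ (V : Type u) (X : Type v) [Fintype V] [Fintype X] (t : ℕ) (G : SimpleGraph V)
        [DecidableRel G.Adj] (typ : X → Fin t), SwapGame.Setting G typ →
        1 ≤ Fintype.card V / t → (t : ℝ) ≤ b * (G.minDegree : ℝ) ^ 3 →
        priceOfAnarchy (colorfulEdges G typ) (uVariety G typ) ≤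
          C * ((G.maxDegree : ℝ) / (t : ℝ) ^ (1 / 3 : ℝ)) := by
  obtain ⟨a, ha, hab⟩ : ∃ a : ℝ, 0 < a ∧ a ^ 3 = b :=
    ⟨b ^ (1 / 3 : ℝ), by positivity, by rw [← Real.rpow_natCast, ← Real.rpow_mul hb.le]; norm_num⟩
  -- The threshold will be `r = ⌈e x⌉` with `x = t ^ (1 / 3)`. As `x ≤ a δ`, the condition `e a ≤ 1`
  -- gives `r ≤ δ`, and `e ≤ 1 / 20` keeps the exceptional vertices below `9 n / 10`.
  obtain ⟨e, he, he1, hea⟩ : ∃ e : ℝ, 0 < e ∧ e ≤ 1 / 20 ∧ e * a ≤ 1 :=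
    ⟨min (1 / 20) (1 / a), by positivity, min_le_left _ _, by
      rw [← le_div_iff₀ ha]; exact min_le_right _ _⟩
  refine ⟨10 / e, by positivity, ?_⟩
  intro V X _ _ t G _ typ h hk ht
  obtain ⟨h3, hn'⟩ := h.mul_div_le
  have hn : (0 : ℝ) < Fintype.card V := by
    have : 0 < Fintype.card V := by omega
    exact_mod_cast this
  have ht3 : (3 : ℝ) ≤ t := by exact_mod_cast h.three_le
  obtain ⟨x, hx, hx0, hxt⟩ : ∃ x : ℝ, (t : ℝ) ^ (1 / 3 : ℝ) = x ∧ 0 < x ∧ x ^ 3 = t :=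
    ⟨_, rfl, by positivity, by
      rw [← Real.rpow_natCast, ← Real.rpow_mul (by linarith)]; norm_num⟩
  have hx1 : 1 ≤ x := by
    by_contra hlt
    have := pow_le_one₀ (n := 3) hx0.le (not_le.1 hlt).le
    linarith
  have hr : ⌈e * x⌉₊ ≤ G.minDegree := by
    rw [Nat.ceil_le]
    have e1 : x ≤ a * G.minDegree := by
      refine le_of_pow_le_pow_left₀ (n := 3) (by norm_num) (by positivity) ?_
      rw [hxt, mul_pow, hab]
      exact ht
    calc e * x ≤ e * (a * G.minDegree) := by gcongr
      _ = (e * a) * G.minDegree := by ring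
      _ ≤ 1 * G.minDegree := by gcongr
      _ = _ := one_mul _
  rw [hx]
  refine (priceOfAnarchy_le (uVariety_eq G typ) (isPotential_varietyAt G)
    h.equitable.card_eq numNbrs_le_maxDegree (m := Fintype.card V * (e * x) / 10) (by positivity)
    fun L hL => ?_).trans (le_of_eq (by field_simp))
  refine le_trans ?_ (mul_le_sum_numOther_of_varietyAt (β := 9 / 10 * Fintype.card V) hr
    (h.colorBound L) hk minDegree_le_numNbrs hL ?_)
  · have := mul_le_mul_of_nonneg_left (Nat.le_ceil (e * x)) hn.le
    linarith
  · set k : ℝ := ((Fintype.card V / t : ℕ) : ℝ)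
    have hk0 : 0 ≤ k := by positivity
    have e2 : (⌈e * x⌉₊ : ℝ) ≤ x / 20 + 1 := by
      have e3 := Nat.ceil_lt_add_one (mul_pos he hx0).le
      have e4 : e * x ≤ 1 / 20 * x := by gcongr
      linarith
    have e5 : x ≤ x ^ 3 := le_self_pow₀ hx1 (by norm_num)
    have e6 : x ^ 2 ≤ x ^ 3 := pow_le_pow_right₀ hx1 (by norm_num)
    have e7 : 2 * (x / 20 + 1) ^ 2 ≤ 9 / 10 * t := by
      rw [← hxt] at ht3 ⊢
      nlinarith
    calc 2 * (⌈e * x⌉₊ : ℝ) ^ 2 * k ≤ 2 * (x / 20 + 1) ^ 2 * k := by gcongr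
      _ ≤ 9 / 10 * t * k := by gcongr
      _ = 9 / 10 * (t * k) := by ring
      _ ≤ _ := by gcongr

end Main

/-! ### The graph `G*` is regular. -/

section GStar

lemma add_mod_cases {a b q : ℕ} (ha : a < q) (hb : b ≤ q) :
    (a + b < q ∧ (a + b) % q = a + b) ∨ (q ≤ a + b ∧ (a + b) % q = a + b - q) := by
  rcases lt_or_ge (a + b) q with h | h
  · exact Or.inl ⟨h, Nat.mod_eq_of_lt h⟩
  · refine Or.inr ⟨h, ?_⟩
    rw [Nat.mod_eq_sub_mod h, Nat.mod_eq_of_lt (by omega)]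

lemma ncard_rEdge_right {q d : ℕ} (hd : d ≤ q) (j : Fin q) :
    {l : Fin q | rEdge q d j l}.ncard = d := by
  have hq : 0 < q := j.pos
  have h : {l : Fin q | rEdge q d j l} =
      (fun s : ℕ => (⟨(j + s) % q, Nat.mod_lt _ hq⟩ : Fin q)) '' (Finset.range d : Set ℕ) := by
    ext l
    simp [rEdge, Fin.ext_iff, eq_comm]
  rw [h, Set.InjOn.ncard_image, Set.ncard_coe_finset, Finset.card_range]
  intro s hs s' hs' he
  simp only [Finset.coe_range, Set.mem_Iio, Fin.mk.injEq] at hs hs' he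
  have h1 := add_mod_cases j.2 (show s ≤ q by omega)
  have h2 := add_mod_cases j.2 (show s' ≤ q by omega)
  omega

lemma ncard_rEdge_left {q d : ℕ} (hd : d ≤ q) (l : Fin q) :
    {j : Fin q | rEdge q d j l}.ncard = d := by
  have hq : 0 < q := l.pos
  -- The index is `l - s` modulo `q`, written as `l + (q - s)` because natural subtraction
  -- truncates.
  have h : {j : Fin q | rEdge q d j l} =
      (fun s : ℕ => (⟨(l + (q - s)) % q, Nat.mod_lt _ hq⟩ : Fin q)) ''
        (Finset.range d : Set ℕ) := by
    ext j
    simp only [rEdge, Set.mem_ofPred_eq, Finset.coe_range, Set.mem_image, Set.mem_Iio, Fin.ext_iff]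
    refine exists_congr fun s => and_congr_right fun hs => ?_
    have h1 := add_mod_cases j.2 (show s ≤ q by omega)
    have h2 := add_mod_cases l.2 (show q - s ≤ q by omega)
    have := j.2
    have := l.2
    omega
  rw [h, Set.InjOn.ncard_image, Set.ncard_coe_finset, Finset.card_range]
  intro s hs s' hs' he
  simp only [Finset.coe_range, Set.mem_Iio, Fin.mk.injEq] at hs hs' he
  have h1 := add_mod_cases l.2 (show q - s ≤ q by omega)
  have h2 := add_mod_cases l.2 (show q - s' ≤ q by omega)
  omega

lemma rEdge_self {q d : ℕ} (hd : 1 ≤ d) (j : Fin q) : rEdge q d j j :=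
  ⟨0, hd, by rw [add_zero, Nat.mod_eq_of_lt j.2]⟩

lemma succ_mod_eq_iff {i j m : ℕ} (hi : i < m) (hj : j < m) :
    i = (j + 1) % m ↔ (i = 0 ∧ j + 1 = m) ∨ i = j + 1 := by
  have := add_mod_cases hj (show 1 ≤ m by omega)
  omega

variable {t d q : ℕ}

/-- Apart from the edges inside its block, the vertex `x.2` of the side `A_{x.1}` of one of the
first blocks has exactly one neighbour. -/
lemma exists_gStarEdge_left_iff (ht : 3 ≤ t) (htq : t - 1 ≤ q) (x : Fin t × Fin q)
    (hx : (x.1 : ℕ) < t - 1) : ∃ z : Fin t × Fin q, z.1 ≠ x.1 ∧ ∀ y, gStarEdge t d q x y ↔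
      (y.1 = x.1 ∧ rEdge q (d - 1) x.2 y.2) ∨ y = z := by
  obtain ⟨i, j⟩ := x
  have hi := i.2
  have hj := j.2
  dsimp only at hx
  -- Index 0 is left out of the cyclic matching and is joined to the last block instead. Every other
  -- index is matched to the preceding block, where `t - 2` precedes 0; it is a different block
  -- because `t - 1 ≥ 2`.
  by_cases hj0 : (j : ℕ) = 0
  · refine ⟨(⟨t - 1, by omega⟩, ⟨i, by omega⟩), fun e => ?_, fun y => ?_⟩
    · rw [Fin.ext_iff] at e
      dsimp only at e
      omega
    · obtain ⟨k, l⟩ := y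
      have hk := k.2
      simp only [gStarEdge, Prod.mk.injEq, Fin.ext_iff]
      have : ¬ (i : ℕ) = t - 1 := by omega
      simp only [hx, this, hj0, false_and, true_and, false_or, ne_eq, not_true, and_false,
        eq_comm (a := (k : ℕ)) (b := (i : ℕ))]
  · refine ⟨(⟨if (i : ℕ) = 0 then t - 2 else i - 1, by split_ifs <;> omega⟩, j), fun e => ?_,
      fun y => ?_⟩
    · rw [Fin.ext_iff] at e
      dsimp only at e
      split_ifs at e <;> omega
    · obtain ⟨k, l⟩ := y
      have hk := k.2
      simp only [gStarEdge, Prod.mk.injEq, Fin.ext_iff]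
      have h1 : ¬ (i : ℕ) = t - 1 := by omega
      simp only [hx, h1, hj0, false_and, true_and, or_false, ne_eq, not_false_eq_true,
        and_false, and_true, eq_comm (a := (k : ℕ)) (b := (i : ℕ))]
      refine or_congr Iff.rfl ?_
      constructor
      · rintro ⟨h2, h3, h4⟩
        rw [succ_mod_eq_iff hx h2] at h3
        refine ⟨?_, h4.symm⟩
        split_ifs <;> omega
      · rintro ⟨h2, h3⟩
        have h4 : (k : ℕ) < t - 1 := by split_ifs at h2 <;> omega
        refine ⟨h4, ?_, h3.symm⟩
        rw [succ_mod_eq_iff hx h4]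
        split_ifs at h2 <;> omega

/-- Apart from the edges inside its block, the vertex `y.2` of the side `B_{y.1}` of one of the
first blocks has exactly one neighbour. -/
lemma exists_gStarEdge_right_iff (ht : 3 ≤ t) (htq : t - 1 ≤ q) (y : Fin t × Fin q)
    (hy : (y.1 : ℕ) < t - 1) : ∃ z : Fin t × Fin q, z.1 ≠ y.1 ∧ ∀ x, gStarEdge t d q x y ↔
      (x.1 = y.1 ∧ rEdge q (d - 1) x.2 y.2) ∨ x = z := by
  obtain ⟨k, l⟩ := y
  have hk := k.2
  have hl := l.2
  dsimp only at hy
  by_cases hl0 : (l : ℕ) = 0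
  · refine ⟨(⟨t - 1, by omega⟩, ⟨k, by omega⟩), fun e => ?_, fun x => ?_⟩
    · rw [Fin.ext_iff] at e
      dsimp only at e
      omega
    · obtain ⟨i, j⟩ := x
      have hi := i.2
      simp only [gStarEdge, Prod.mk.injEq, Fin.ext_iff]
      have h1 : ¬ (k : ℕ) = t - 1 := by omega
      simp only [hy, h1, hl0, false_and, true_and, and_false, false_or, or_false]
      constructor
      · rintro (h | h | h)
        · exact Or.inl h.2
        · exact absurd (h.2.2.1) h.2.2.2
        · exact Or.inr h
      · rintro (h | h)
        · exact Or.inl ⟨by omega, h⟩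
        · exact Or.inr (Or.inr h)
  · refine ⟨(⟨if (k : ℕ) + 1 = t - 1 then 0 else k + 1, by split_ifs <;> omega⟩, l), fun e => ?_,
      fun x => ?_⟩
    · rw [Fin.ext_iff] at e
      dsimp only at e
      split_ifs at e <;> omega
    · obtain ⟨i, j⟩ := x
      have hi := i.2
      simp only [gStarEdge, Prod.mk.injEq, Fin.ext_iff]
      have h1 : ¬ (k : ℕ) = t - 1 := by omega
      simp only [hy, h1, hl0, false_and, true_and, and_false, or_false]
      constructor
      · rintro (h | ⟨h2, h3, h4, -⟩)
        · exact Or.inl h.2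
        · rw [succ_mod_eq_iff h2 hy] at h3
          refine Or.inr ⟨?_, h4⟩
          split_ifs <;> omega
      · rintro (h | ⟨h2, h3⟩)
        · exact Or.inl ⟨by omega, h⟩
        · have h4 : (i : ℕ) < t - 1 := by split_ifs at h2 <;> omega
          refine Or.inr ⟨h4, ?_, h3, by omega⟩
          rw [succ_mod_eq_iff h4 hy]
          split_ifs at h2 <;> omega

lemma gStarEdge_last_left_iff (x y : Fin t × Fin q) (hx : (x.1 : ℕ) = t - 1) :
    gStarEdge t d q x y ↔
      (y.1 = x.1 ∧ rEdge q d x.2 y.2 ∧ ¬ (y.2 = x.2 ∧ (x.2 : ℕ) < t - 1)) ∨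
      ((x.2 : ℕ) < t - 1 ∧ (y.1 : ℕ) = x.2 ∧ (y.2 : ℕ) = 0) := by
  obtain ⟨i, j⟩ := x
  obtain ⟨k, l⟩ := y
  dsimp only at hx
  simp only [gStarEdge, Fin.ext_iff, hx, lt_irrefl, false_and, false_or, true_and, or_false]
  rw [eq_comm (a := (j : ℕ)) (b := (l : ℕ)), eq_comm (a := (j : ℕ)) (b := (k : ℕ))]
  refine or_congr Iff.rfl ⟨fun h => ⟨?_, h.2.2, h.2.1⟩, fun h => ⟨?_, h.2.2, h.2.1⟩⟩ <;> omega

lemma gStarEdge_last_right_iff (x y : Fin t × Fin q) (hy : (y.1 : ℕ) = t - 1) :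
    gStarEdge t d q x y ↔
      (x.1 = y.1 ∧ rEdge q d x.2 y.2 ∧ ¬ (x.2 = y.2 ∧ (y.2 : ℕ) < t - 1)) ∨
      ((y.2 : ℕ) < t - 1 ∧ (x.1 : ℕ) = y.2 ∧ (x.2 : ℕ) = 0) := by
  obtain ⟨i, j⟩ := x
  obtain ⟨k, l⟩ := y
  dsimp only at hy
  simp only [gStarEdge, Fin.ext_iff, hy, lt_irrefl, false_and, true_and, and_false, false_or]
  constructor
  · rintro (h | h | h)
    · omega
    · exact Or.inl ⟨h.1, h.2.1, fun e => h.2.2 ⟨e.1, by omega⟩⟩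
    · exact Or.inr ⟨by omega, h.2.2.symm, h.2.1⟩
  · rintro (h | h)
    · exact Or.inr (Or.inl ⟨h.1, h.2.1, fun e => h.2.2 ⟨e.1, by omega⟩⟩)
    · exact Or.inr (Or.inr ⟨by omega, h.2.2, h.2.1.symm⟩)

lemma ncard_of_block {S : Set (Fin t × Fin q)} (i : Fin t) (R : Set (Fin q))
    (z : Fin t × Fin q) (hz : z.1 ≠ i) (h : ∀ y, y ∈ S ↔ (y.1 = i ∧ y.2 ∈ R) ∨ y = z) :
    S.ncard = R.ncard + 1 := by
  have e : S = insert z (Prod.mk i '' R) := by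
    ext ⟨k, l⟩
    rw [h]
    simp only [Set.mem_insert_iff, Set.mem_image, Prod.mk.injEq]
    constructor
    · rintro (⟨rfl, hl⟩ | h)
      · exact Or.inr ⟨l, hl, rfl, rfl⟩
      · exact Or.inl h
    · rintro (h | ⟨l', hl, rfl, rfl⟩)
      · exact Or.inr h
      · exact Or.inl ⟨rfl, hl⟩
  rw [e, Set.ncard_insert_of_notMem, Set.ncard_image_of_injective _ (Prod.mk_right_injective i)]
  rintro ⟨l, -, rfl⟩
  exact hz rfl

/-- In the last block a removed diagonal edge is replaced by exactly one edge to an earlier block,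
so degrees do not change. -/
lemma ncard_of_last_block {S : Set (Fin t × Fin q)} (i : Fin t) (hi : (i : ℕ) = t - 1)
    (R : Set (Fin q)) (j : Fin q) (hj : j ∈ R)
    (h : ∀ y, y ∈ S ↔ (y.1 = i ∧ y.2 ∈ R ∧ ¬ (y.2 = j ∧ (j : ℕ) < t - 1)) ∨
      ((j : ℕ) < t - 1 ∧ (y.1 : ℕ) = j ∧ (y.2 : ℕ) = 0)) :
    S.ncard = R.ncard := by
  by_cases hlt : (j : ℕ) < t - 1
  · rw [← Set.ncard_sdiff_singleton_add_one hj]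
    refine ncard_of_block i (R \ {j}) (⟨j, by omega⟩, ⟨0, by omega⟩) (fun e => ?_) fun y => ?_
    · rw [Fin.ext_iff] at e
      dsimp only at e
      omega
    · rw [h]
      simp only [hlt, and_true, true_and, Set.mem_sdiff, Set.mem_singleton_iff, Prod.ext_iff,
        Fin.ext_iff]
  · have e : S = Prod.mk i '' R := by
      ext ⟨k, l⟩
      rw [h]
      simp only [hlt, and_false, not_false_eq_true, and_true, false_and, or_false, Set.mem_image,
        Prod.mk.injEq]
      constructor
      · rintro ⟨rfl, hl⟩
        exact ⟨l, hl, rfl, rfl⟩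
      · rintro ⟨l', hl, rfl, rfl⟩
        exact ⟨rfl, hl⟩
    rw [e, Set.ncard_image_of_injective _ (Prod.mk_right_injective i)]

lemma ncard_neighborSet_gStar (ht : 3 ≤ t) (hd : 1 ≤ d) (hdq : d ≤ q) (htq : t - 1 ≤ q)
    (x : (Fin t × Fin q) ⊕ (Fin t × Fin q)) : ((gStar t d q).neighborSet x).ncard = d := by
  rcases x with x | y
  · have e : (gStar t d q).neighborSet (Sum.inl x) = Sum.inr '' {y | gStarEdge t d q x y} := by
      ext (y | y) <;> simp [gStar]
    rw [e, Set.ncard_image_of_injective _ Sum.inr_injective]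
    rcases Nat.lt_or_ge (x.1 : ℕ) (t - 1) with hx | hx
    · obtain ⟨z, hz, h⟩ := exists_gStarEdge_left_iff (d := d) ht htq x hx
      rw [ncard_of_block (S := {y | gStarEdge t d q x y}) x.1 {l | rEdge q (d - 1) x.2 l} z hz h,
        ncard_rEdge_right (by omega)]
      omega
    · have hx' : (x.1 : ℕ) = t - 1 := by have := x.1.2; omega
      rw [ncard_of_last_block (S := {y | gStarEdge t d q x y}) x.1 hx'
        {l | rEdge q d x.2 l} x.2 (rEdge_self hd _)
        fun y => gStarEdge_last_left_iff x y hx', ncard_rEdge_right hdq]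
  · have e : (gStar t d q).neighborSet (Sum.inr y) = Sum.inl '' {x | gStarEdge t d q x y} := by
      ext (x | x) <;> simp [gStar]
    rw [e, Set.ncard_image_of_injective _ Sum.inl_injective]
    rcases Nat.lt_or_ge (y.1 : ℕ) (t - 1) with hy | hy
    · obtain ⟨z, hz, h⟩ := exists_gStarEdge_right_iff (d := d) ht htq y hy
      rw [ncard_of_block (S := {x | gStarEdge t d q x y}) y.1 {j | rEdge q (d - 1) j y.2} z hz h,
        ncard_rEdge_left (by omega)]
      omega
    · have hy' : (y.1 : ℕ) = t - 1 := by have := y.1.2; omega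
      rw [ncard_of_last_block (S := {x | gStarEdge t d q x y}) y.1 hy'
        {j | rEdge q d j y.2} y.2 (rEdge_self hd _)
        fun x => gStarEdge_last_right_iff x y hy', ncard_rEdge_left hdq]

lemma numNbrs_gStar (ht : 3 ≤ t) (hd : 1 ≤ d) (hdq : d ≤ q) (htq : t - 1 ≤ q)
    (x : (Fin t × Fin q) ⊕ (Fin t × Fin q)) : numNbrs (gStar t d q) x = d := by
  classical
  refine Eq.trans ?_ (ncard_neighborSet_gStar ht hd hdq htq x)
  unfold numNbrs
  rw [← Set.ncard_coe_finset]
  congr 1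
  ext y
  simp

end GStar

/-! ### Tightness on `G*`: a poor equilibrium and a nearly perfect colouring. -/

section Tightness

variable {V : Type u} {X : Type v} [Fintype V] [Fintype X] {t : ℕ} {G : SimpleGraph V}
  {typ : X → Fin t}

omit [Fintype V] in
/-- If all types have the same number of agents, then they can be placed according to every
partition of the vertices into sets of this size. -/
lemma exists_equiv_of_equiv_prod {F : Type*} [Fintype F]
    (h : ∀ i, (Finset.univ.filter fun A => typ A = i).card = Fintype.card F)
    (e : V ≃ Fin t × F) : ∃ L : X ≃ V, typ ∘ L.symm = fun v => (e v).1 := by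
  classical
  have h' : ∀ i, Fintype.card {A // typ A = i} = Fintype.card F := fun i => by
    rw [Fintype.card_subtype, h]
  obtain ⟨L, hL⟩ : ∃ L : X ≃ V, ∀ A, (e (L A)).1 = typ A := ⟨(Equiv.sigmaFiberEquiv typ).symm.trans
    ((Equiv.sigmaCongrRight fun i => Fintype.equivOfCardEq (h' i)).trans
      ((Equiv.sigmaEquivProd _ _).trans e.symm)), fun A => by simp [Equiv.sigmaFiberEquiv]⟩
  refine ⟨L, ?_⟩
  funext v
  obtain ⟨A, rfl⟩ := L.surjective v
  rw [Function.comp_apply, L.symm_apply_apply, hL]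

omit [Fintype V] in
lemma div_le_priceOfAnarchy {U : (X ≃ V) → X → ℝ} (L₁ L₂ : X ≃ V) (hL : IsEquilibrium U L₂)
    (h : 0 < ⨅ L : {L : X ≃ V // IsEquilibrium U L}, colorfulEdges G typ L) :
    colorfulEdges G typ L₁ / colorfulEdges G typ L₂ ≤ priceOfAnarchy (colorfulEdges G typ) U := by
  have h1 : colorfulEdges G typ L₁ ≤ ⨆ L : X ≃ V, colorfulEdges G typ L :=
    le_ciSup (Set.finite_range _).bddAbove L₁
  have h2 := ciInf_le (f := fun L : {L : X ≃ V // IsEquilibrium U L} => colorfulEdges G typ L)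
    (Set.finite_range _).bddBelow ⟨L₂, hL⟩
  unfold priceOfAnarchy
  have h3 : 0 ≤ colorfulEdges G typ L₁ := colorfulEdges_nonneg L₁
  exact div_le_div₀ (h3.trans h1) h1 h h2

variable {d q : ℕ}

/-- Each type has at least `2 q` agents and the total is `t (2 q)`, so no type can have one more. -/
lemma card_type_eq {typ : X → Fin t}
    (h : Equitable ((Fin t × Fin q) ⊕ (Fin t × Fin q)) typ) (ht : 3 ≤ t) (i : Fin t) :
    (Finset.univ.filter fun A => typ A = i).card = 2 * q := by
  classical
  have hcard : Fintype.card ((Fin t × Fin q) ⊕ (Fin t × Fin q)) = t * (2 * q) := by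
    simp only [Fintype.card_sum, Fintype.card_prod, Fintype.card_fin]
    ring
  have hle : ∀ i ∈ Finset.univ, 2 * q ≤ (Finset.univ.filter fun A => typ A = i).card := by
    intro i _
    have := h.card_type i
    rw [hcard, Nat.mul_div_cancel_left _ (by omega)] at this
    omega
  refine ((Finset.sum_eq_sum_iff_of_le hle).1 ?_ i (Finset.mem_univ i)).symm
  rw [← Finset.card_eq_sum_card_fiberwise (fun A _ => Finset.mem_univ (typ A)), Finset.card_univ,
    h.card_eq, hcard]
  simp

/-- The index of the block that contains a vertex of `G*`. -/
def blockColor (x : (Fin t × Fin q) ⊕ (Fin t × Fin q)) : Fin t := x.elim Prod.fst Prod.fst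

lemma eq_or_of_gStar_adj_blockColor_ne (ht : 3 ≤ t) (htq : t - 1 ≤ q)
    (x : (Fin t × Fin q) ⊕ (Fin t × Fin q)) (hx : (blockColor x : ℕ) < t - 1) :
    ∃ z, blockColor z ≠ blockColor x ∧ (gStar t d q).Adj x z ∧
      ∀ y, (gStar t d q).Adj x y → blockColor y ≠ blockColor x → y = z := by
  rcases x with x | x
  · obtain ⟨z, hz, h⟩ := exists_gStarEdge_left_iff (d := d) ht htq x hx
    refine ⟨Sum.inr z, hz, (h z).2 (Or.inr rfl), ?_⟩
    rintro (y | y) hy hne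
    · exact hy.elim
    · rcases (h y).1 hy with h1 | h1
      · exact (hne h1.1).elim
      · rw [h1]
  · obtain ⟨z, hz, h⟩ := exists_gStarEdge_right_iff (d := d) ht htq x hx
    refine ⟨Sum.inl z, hz, (h z).2 (Or.inr rfl), ?_⟩
    rintro (y | y) hy hne
    · rcases (h y).1 hy with h1 | h1
      · exact (hne h1.1).elim
      · rw [h1]
    · exact hy.elim

lemma numOther_blockColor_eq_one (ht : 3 ≤ t) (htq : t - 1 ≤ q)
    (x : (Fin t × Fin q) ⊕ (Fin t × Fin q)) (hx : (blockColor x : ℕ) < t - 1) :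
    numOther (gStar t d q) blockColor x = 1 := by
  classical
  obtain ⟨z, hz, hxz, h⟩ := eq_or_of_gStar_adj_blockColor_ne (d := d) ht htq x hx
  unfold numOther
  rw [Finset.card_eq_one]
  refine ⟨z, ?_⟩
  ext y
  simp only [Finset.mem_filter, Finset.mem_univ, true_and, Finset.mem_singleton]
  exact ⟨fun hy => h y hy.1 hy.2, by rintro rfl; exact ⟨hxz, hz⟩⟩

/-- The index of a vertex of `G*` in its side of its block. -/
def innerIndex (x : (Fin t × Fin q) ⊕ (Fin t × Fin q)) : Fin q := x.elim Prod.snd Prod.snd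

/-- A neighbour in another block is determined by `x`: it has index 0, lies on the opposite side,
and its block number is the index of `x`. -/
lemma numOther_blockColor_last (x : (Fin t × Fin q) ⊕ (Fin t × Fin q))
    (hx : (blockColor x : ℕ) = t - 1) :
    numOther (gStar t d q) blockColor x ≤ if (innerIndex x : ℕ) < t - 1 then 1 else 0 := by
  classical
  have key : ∀ y, (gStar t d q).Adj x y → blockColor y ≠ blockColor x →
      (innerIndex x : ℕ) < t - 1 ∧ (blockColor y : ℕ) = innerIndex x ∧ (innerIndex y : ℕ) = 0 ∧
      (y.isLeft = !x.isLeft) := by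
    rcases x with x | x
    · rintro (y | y) hy hne
      · exact hy.elim
      · rcases (gStarEdge_last_left_iff x y hx).1 hy with h1 | h1
        · exact (hne h1.1).elim
        · exact ⟨h1.1, h1.2.1, h1.2.2, rfl⟩
    · rintro (y | y) hy hne
      · rcases (gStarEdge_last_right_iff y x hx).1 hy with h1 | h1
        · exact (hne h1.1).elim
        · exact ⟨h1.1, h1.2.1, h1.2.2, rfl⟩
      · exact hy.elim
  split_ifs with hlt
  · unfold numOther
    rw [Finset.card_le_one]
    intro y hy z hz
    simp only [Finset.mem_filter, Finset.mem_univ, true_and] at hy hz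
    obtain ⟨-, a1, a2, a3⟩ := key y hy.1 hy.2
    obtain ⟨-, b1, b2, b3⟩ := key z hz.1 hz.2
    rw [← b1] at a1
    rw [← b2] at a2
    rw [← b3] at a3
    rcases y with ⟨y1, y2⟩ | ⟨y1, y2⟩ <;> rcases z with ⟨z1, z2⟩ | ⟨z1, z2⟩ <;>
      simp_all [blockColor, innerIndex, Fin.ext_iff]
  · rw [← not_lt, numOther_pos]
    rintro ⟨y, h1, h2⟩
    exact hlt (key y h1 h2).1

lemma sum_numOther_blockColor_le (ht : 3 ≤ t) (htq : t - 1 ≤ q) :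
    ∑ x, numOther (gStar t d q) blockColor x ≤ 2 * ((t - 1) * (q + 1)) := by
  classical
  have h1 : ∀ x : (Fin t × Fin q) ⊕ (Fin t × Fin q), numOther (gStar t d q) blockColor x ≤
      (if (blockColor x : ℕ) < t - 1 then 1 else 0) +
        if (blockColor x : ℕ) = t - 1 ∧ (innerIndex x : ℕ) < t - 1 then 1 else 0 := by
    intro x
    have hlt := (blockColor x).2
    rcases Nat.lt_or_ge (blockColor x : ℕ) (t - 1) with hx | hx
    · rw [numOther_blockColor_eq_one ht htq x hx, if_pos hx]
      omega
    · have hx' : (blockColor x : ℕ) = t - 1 := by omega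
      refine (numOther_blockColor_last x hx').trans ?_
      simp [hx']
  have h2 : ∑ x : Fin t × Fin q, ((if (x.1 : ℕ) < t - 1 then 1 else 0) +
      if (x.1 : ℕ) = t - 1 ∧ (x.2 : ℕ) < t - 1 then 1 else 0) ≤ (t - 1) * (q + 1) := by
    have a1 : (Finset.univ.filter fun i : Fin t => (i : ℕ) < t - 1).card ≤ t - 1 := by
      refine (Finset.card_le_card_of_injOn (t := Finset.range (t - 1)) (fun i : Fin t => (i : ℕ))
        (fun i hi => by simpa using hi) Fin.val_injective.injOn).trans (by simp)
    have a2 : (Finset.univ.filter fun i : Fin q => (i : ℕ) < t - 1).card ≤ t - 1 := by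
      refine (Finset.card_le_card_of_injOn (t := Finset.range (t - 1)) (fun i : Fin q => (i : ℕ))
        (fun i hi => by simpa using hi) Fin.val_injective.injOn).trans (by simp)
    have a3 : (Finset.univ.filter fun i : Fin t => (i : ℕ) = t - 1).card ≤ 1 := by
      rw [Finset.card_le_one]
      intro i hi j hj
      simp only [Finset.mem_filter, Finset.mem_univ, true_and] at hi hj
      exact Fin.ext (hi.trans hj.symm)
    rw [Finset.sum_add_distrib, ← Finset.card_filter, ← Finset.card_filter]
    have b1 : (Finset.univ.filter fun x : Fin t × Fin q => (x.1 : ℕ) < t - 1) =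
        (Finset.univ.filter fun i : Fin t => (i : ℕ) < t - 1) ×ˢ Finset.univ := by
      ext; simp
    have b2 : (Finset.univ.filter fun x : Fin t × Fin q =>
        (x.1 : ℕ) = t - 1 ∧ (x.2 : ℕ) < t - 1) =
        (Finset.univ.filter fun i : Fin t => (i : ℕ) = t - 1) ×ˢ
          (Finset.univ.filter fun i : Fin q => (i : ℕ) < t - 1) := by
      ext; simp
    rw [b1, b2, Finset.card_product, Finset.card_product, Finset.card_univ, Fintype.card_fin]
    calc _ ≤ (t - 1) * q + 1 * (t - 1) := by gcongr
      _ = _ := by ring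
  refine (Finset.sum_le_sum fun x _ => h1 x).trans ?_
  rw [Fintype.sum_sum_type]
  exact (add_le_add h2 h2).trans (two_mul _).ge

/-- Only vertices of the last block can have binary utility 0, and they share one colour, so no two
agents can both gain. -/
lemma not_improves_blockColor (ht : 3 ≤ t) (htq : t - 1 ≤ q)
    (v w : (Fin t × Fin q) ⊕ (Fin t × Fin q)) :
    ¬ Improves (binaryAt (gStar t d q)) blockColor v w := by
  intro hi
  have key : ∀ x c' y, binaryAt (gStar t d q) (blockColor (t := t) (q := q)) x <
      binaryAt (gStar t d q) (ι := Fin t) c' y → (blockColor x : ℕ) = t - 1 := by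
    intro x c' y h
    by_contra hne
    have h1 := numOther_blockColor_eq_one (d := d) ht htq x
      (by have := (blockColor x).2; omega)
    unfold binaryAt at h
    rw [h1] at h
    split_ifs at h <;> omega
  exact hi.color_ne (Fin.ext ((key _ _ _ hi.1).trans (key _ _ _ hi.2).symm))

/-- The vertices of `G*` in an order of the sides of the blocks, cut into pairs of sides. -/
def sidePairs (t q : ℕ) : (Fin t × Fin q) ⊕ (Fin t × Fin q) ≃ Fin t × (Fin 2 × Fin q) :=
  (Equiv.sumProdDistrib _ _ _).symm.trans <|
    (Equiv.prodCongrLeft fun _ => ((Equiv.sumCongr Fin.revPerm Fin.revPerm).trans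
      finSumFinEquiv).trans ((finCongr (by ring)).trans finProdFinEquiv.symm)).trans
      (Equiv.prodAssoc _ _ _)

lemma sidePairs_inl (x : Fin t × Fin q) :
    ((sidePairs t q (Sum.inl x)).1 : ℕ) = (t - (x.1 + 1)) / 2 := by
  simp [sidePairs, Equiv.prodCongrLeft]

lemma sidePairs_inr (x : Fin t × Fin q) :
    ((sidePairs t q (Sum.inr x)).1 : ℕ) = (t + (t - (x.1 + 1))) / 2 := by
  simp [sidePairs, Equiv.prodCongrLeft, add_comm]

/-- The order of the sides is `A_{t-1}, …, A_0, B_{t-1}, …, B_0`. Cutting it into consecutive pairs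
puts an A-side together with a B-side only if `t` is odd, and then the pair is `A_0`, `B_{t-1}`,
between which `G*` has a single edge. -/
lemma eq_of_gStarEdge_of_sidePairs_eq (ht : 3 ≤ t) {x y : Fin t × Fin q}
    (h : gStarEdge t d q x y)
    (he : (sidePairs t q (Sum.inl x)).1 = (sidePairs t q (Sum.inr y)).1) :
    ((x.1 : ℕ) = 0 ∧ (x.2 : ℕ) = 0) ∧ (y.1 : ℕ) = t - 1 ∧ (y.2 : ℕ) = 0 := by
  rw [Fin.ext_iff, sidePairs_inl, sidePairs_inr] at he
  have h1 := x.1.2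
  have h2 := y.1.2
  have h3 : (x.1 : ℕ) = 0 ∧ (y.1 : ℕ) = t - 1 := by omega
  rcases h with h | h | h | h | h
  · have := congrArg Fin.val h.2.1
    omega
  all_goals omega

lemma le_sum_numOther_sidePairs (ht : 3 ≤ t) (hd : 1 ≤ d) (hdq : d ≤ q) (htq : t - 1 ≤ q) :
    (2 * (t * q) - 2 : ℝ) * d ≤
      ((∑ x, numOther (gStar t d q) (fun x => (sidePairs t q x).1) x : ℕ) : ℝ) := by
  classical
  have hB : (({Sum.inl (⟨0, by omega⟩, ⟨0, by omega⟩),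
      Sum.inr (⟨t - 1, by omega⟩, ⟨0, by omega⟩)} :
      Finset ((Fin t × Fin q) ⊕ (Fin t × Fin q))).card : ℝ) ≤ 2 := by
    exact_mod_cast Finset.card_le_two
  have h := sub_mul_le_sum (numOther (gStar t d q) (fun x => (sidePairs t q x).1)) _ hB
    (r := (d : ℝ)) (by positivity) fun x hx => ?_
  · refine le_trans (le_of_eq ?_) h
    simp only [Fintype.card_sum, Fintype.card_prod, Fintype.card_fin]
    push_cast
    ring
  · have h1 := colorCount_add_numOther (gStar t d q) (fun x => (sidePairs t q x).1) x
    rw [numNbrs_gStar ht hd hdq htq] at h1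
    have h2 : colorCount (gStar t d q) (fun x => (sidePairs t q x).1) x (sidePairs t q x).1 = 0 := by
      rw [← Nat.le_zero, ← not_lt, colorCount_pos]
      rintro ⟨y, ha, he⟩
      refine hx ?_
      rw [Finset.mem_insert, Finset.mem_singleton]
      rcases x with x | x <;> rcases y with y | y
      · exact ha.elim
      · obtain ⟨⟨a, b⟩, -⟩ := eq_of_gStarEdge_of_sidePairs_eq ht ha he.symm
        exact Or.inl (congrArg Sum.inl (Prod.ext (Fin.ext a) (Fin.ext b)))
      · obtain ⟨-, a, b⟩ := eq_of_gStarEdge_of_sidePairs_eq ht ha he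
        exact Or.inr (congrArg Sum.inr (Prod.ext (Fin.ext a) (Fin.ext b)))
      · exact ha.elim
    rw [h2, zero_add] at h1
    exact_mod_cast h1.ge

lemma le_sum_numOther_gStar {typ : X → Fin t}
    (h : Equitable ((Fin t × Fin q) ⊕ (Fin t × Fin q)) typ) (ht : 3 ≤ t) (hd : 1 ≤ d)
    (hdq : d ≤ q) (htq : t - 1 ≤ q) (L : X ≃ (Fin t × Fin q) ⊕ (Fin t × Fin q))
    (hL : ∀ v w, ¬ Improves (binaryAt (gStar t d q)) (typ ∘ L.symm) v w) :
    2 * ((t - 1 : ℝ) * q) ≤ ((∑ v, numOther (gStar t d q) (typ ∘ L.symm) v : ℕ) : ℝ) := by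
  have h1 := card_le_sum_numOther_add _ (unhappySwap_binaryAt (gStar t d q))
    (colorBound_of_forall_card_le (fun i => (card_type_eq h ht i).le) L)
    (fun v => by rw [numNbrs_gStar ht hd hdq htq]; exact hd) hL
  simp only [Fintype.card_sum, Fintype.card_prod, Fintype.card_fin] at h1
  have h2 : (t * q + t * q : ℝ) ≤
      ((∑ v, numOther (gStar t d q) (typ ∘ L.symm) v : ℕ) : ℝ) + 2 * q := by exact_mod_cast h1
  linarith

lemma priceOfStability_gStar {typ : X → Fin t}
    (h : Equitable ((Fin t × Fin q) ⊕ (Fin t × Fin q)) typ) (ht : 3 ≤ t) (hd : 1 ≤ d)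
    (hdq : d ≤ q) (htq : t - 1 ≤ q) :
    priceOfStability (colorfulEdges (gStar t d q) typ) (uBinary (gStar t d q) typ) = 1 := by
  refine priceOfStability_eq_one (uBinary_eq _ typ) (isPotential_binaryAt _) h.card_eq ?_
  obtain ⟨L, hL, -⟩ := exists_isEquilibrium (uBinary_eq (gStar t d q) typ)
    (isPotential_binaryAt _) h.card_eq
  refine ⟨L, ?_⟩
  have h1 := le_sum_numOther_gStar h ht hd hdq htq L ((isEquilibrium_iff typ (uBinary_eq _ typ) L).1 hL)
  rw [← two_mul_colorfulEdges] at h1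
  have h2 : (3 : ℝ) ≤ t := by exact_mod_cast ht
  have h3 : (0 : ℝ) < q := by
    have : 0 < q := by omega
    exact_mod_cast this
  have h4 : 0 < (t - 1 : ℝ) * q := mul_pos (by linarith) h3
  linarith

/-- All types have exactly `2 q` agents, so the upper bound `d t / (t - 1)` holds without an error
term. From below, the two colourings give `(t q - 1) d / ((t - 1) (q + 1))`. -/
lemma abs_priceOfAnarchy_gStar_sub_le {typ : X → Fin t}
    (h : Equitable ((Fin t × Fin q) ⊕ (Fin t × Fin q)) typ) (ht : 3 ≤ t) (hd : 1 ≤ d)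
    (hdq : d ≤ q) (htq : t - 1 ≤ q) :
    |priceOfAnarchy (colorfulEdges (gStar t d q) typ) (uBinary (gStar t d q) typ) -
      (d : ℝ) * t / ((t : ℝ) - 1)| ≤ d * (t + 1) / q := by
  have ht' : (3 : ℝ) ≤ t := by exact_mod_cast ht
  have hq : (0 : ℝ) < q := by
    have : 0 < q := by omega
    exact_mod_cast this
  have ht1 : 0 < (t : ℝ) - 1 := by linarith
  have hm : 0 < 2 * ((t - 1 : ℝ) * q) := by positivity
  have hlow := le_sum_numOther_gStar (typ := typ) h ht hd hdq htq
  have hup := priceOfAnarchy_le (uBinary_eq (gStar t d q) typ) (isPotential_binaryAt _) h.card_eq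
    (fun v => (numNbrs_gStar ht hd hdq htq v).le) hm hlow
  have e1 : ((Fintype.card ((Fin t × Fin q) ⊕ (Fin t × Fin q)) : ℕ) : ℝ) * d /
      (2 * ((t - 1 : ℝ) * q)) = d * t / (t - 1) := by
    simp only [Fintype.card_sum, Fintype.card_prod, Fintype.card_fin]
    push_cast
    field_simp
    ring
  rw [e1] at hup
  have hinf := div_two_le_iInf (uBinary_eq (gStar t d q) typ) (isPotential_binaryAt _) h.card_eq hlow
  obtain ⟨L₁, h₁⟩ := exists_equiv_of_equiv_prod (typ := typ)
    (fun i => by rw [card_type_eq h ht i]; simp) (sidePairs t q)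
  obtain ⟨L₂, h₂⟩ := exists_equiv_of_equiv_prod (typ := typ) (F := Fin q ⊕ Fin q)
    (fun i => by rw [card_type_eq h ht i]; simp [two_mul]) (Equiv.prodSumDistrib _ _ _).symm
  have h₂' : typ ∘ L₂.symm = blockColor := by
    rw [h₂]
    funext x
    rcases x with x | x <;> simp [blockColor]
  have hL₂ : IsEquilibrium (uBinary (gStar t d q) typ) L₂ := by
    rw [isEquilibrium_iff typ (uBinary_eq _ typ), h₂']
    exact not_improves_blockColor ht htq
  have hpoa := div_le_priceOfAnarchy L₁ L₂ hL₂ (lt_of_lt_of_le (by linarith) hinf)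
  have c1 := two_mul_colorfulEdges (gStar t d q) typ L₁
  have c2 := two_mul_colorfulEdges (gStar t d q) typ L₂
  have c3 := le_sum_numOther_sidePairs ht hd hdq htq
  have c4 : ((∑ x, numOther (gStar t d q) (typ ∘ L₂.symm) x : ℕ) : ℝ) ≤
      2 * ((t - 1) * (q + 1)) := by
    rw [h₂']
    have := sum_numOther_blockColor_le (d := d) ht htq
    have e : ((t - 1 : ℕ) : ℝ) = t - 1 := by rw [Nat.cast_sub (by omega)]; simp
    rw [← e]
    exact_mod_cast this
  rw [h₁] at c1
  have hpos : 0 < colorfulEdges (gStar t d q) typ L₂ := by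
    have := hlow L₂ ((isEquilibrium_iff typ (uBinary_eq _ typ) L₂).1 hL₂)
    linarith
  have hd' : (1 : ℝ) ≤ d := by exact_mod_cast hd
  have htq' : (1 : ℝ) ≤ t * q := by
    have : 1 ≤ t * q := Nat.mul_pos (by omega) (by omega)
    exact_mod_cast this
  have c5 : (t * q - 1 : ℝ) * d / ((t - 1) * (q + 1)) ≤
      colorfulEdges (gStar t d q) typ L₁ / colorfulEdges (gStar t d q) typ L₂ :=
    div_le_div₀ (colorfulEdges_nonneg _) (by linarith) hpos (by linarith)
  have c6 : (d : ℝ) * t / (t - 1) - (t * q - 1 : ℝ) * d / ((t - 1) * (q + 1)) =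
      d * (t + 1) / ((t - 1) * (q + 1)) := by
    field_simp
    ring
  have c7 : (d : ℝ) * (t + 1) / ((t - 1) * (q + 1)) ≤ d * (t + 1) / q := by
    gcongr
    nlinarith
  rw [abs_le]
  constructor <;> linarith [show (0 : ℝ) ≤ d * (t + 1) / q by positivity]

end Tightness

end SwapGame

theorem mainTheorem3 :
    -- equilibria exist and have a colorful edge, so that the ratios below are meaningful
    (∀ (V : Type u) (X : Type v) [Fintype V] [Fintype X] (t : ℕ) (G : SimpleGraph V)
        (typ : X → Fin t), SwapGame.Setting G typ → 2 ≤ Fintype.card V →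
      ((∃ L : X ≃ V, SwapGame.IsEquilibrium (SwapGame.uBinary G typ) L) ∧
       (∃ L : X ≃ V, SwapGame.IsEquilibrium (SwapGame.uDiff G typ) L) ∧
       (∃ L : X ≃ V, SwapGame.IsEquilibrium (SwapGame.uVariety G typ) L) ∧
       (∀ L : X ≃ V, 0 < SwapGame.colorfulEdges G typ L))) ∧
    -- (1) upper bound for the binary utility
    (∀ ε : ℝ, 0 < ε → ∃ K : ℕ,
      ∀ (V : Type u) (X : Type v) [Fintype V] [Fintype X] (t : ℕ) (G : SimpleGraph V)
        [DecidableRel G.Adj] (typ : X → Fin t), SwapGame.Setting G typ →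
        K ≤ Fintype.card V / t →
        SwapGame.priceOfAnarchy (SwapGame.colorfulEdges G typ) (SwapGame.uBinary G typ) ≤
          (1 + ε) * ((G.maxDegree : ℝ) * t / ((t : ℝ) - 1))) ∧
    -- (1) the graph `G*` is regular, its price of stability is one
    (∀ (t d q : ℕ), 3 ≤ t → 1 ≤ d → d ≤ q → t - 1 ≤ q →
      (∀ x, ((SwapGame.gStar t d q).neighborSet x).ncard = d) ∧
      (∀ (X : Type v) [Fintype X] (typ : X → Fin t),
        SwapGame.Equitable ((Fin t × Fin q) ⊕ (Fin t × Fin q)) typ →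
        SwapGame.priceOfStability (SwapGame.colorfulEdges (SwapGame.gStar t d q) typ)
          (SwapGame.uBinary (SwapGame.gStar t d q) typ) = 1)) ∧
    -- (1) tightness of the upper bound on `G*`
    (∀ (t d : ℕ), 3 ≤ t → 1 ≤ d → ∀ ε : ℝ, 0 < ε → ∃ Q : ℕ, ∀ q : ℕ, Q ≤ q →
      ∀ (X : Type v) [Fintype X] (typ : X → Fin t),
        SwapGame.Equitable ((Fin t × Fin q) ⊕ (Fin t × Fin q)) typ →
        |SwapGame.priceOfAnarchy (SwapGame.colorfulEdges (SwapGame.gStar t d q) typ)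
            (SwapGame.uBinary (SwapGame.gStar t d q) typ) -
          (d : ℝ) * t / ((t : ℝ) - 1)| ≤ ε) ∧
    -- (2) colorful edges and social welfare have the same price of anarchy
    (∀ (V : Type u) (X : Type v) [Fintype V] [Fintype X] (t : ℕ) (G : SimpleGraph V)
        (typ : X → Fin t), SwapGame.Setting G typ →
      SwapGame.priceOfAnarchy (SwapGame.colorfulEdges G typ) (SwapGame.uDiff G typ) =
        SwapGame.priceOfAnarchy (SwapGame.socialWelfare (SwapGame.uDiff G typ))
          (SwapGame.uDiff G typ)) ∧
    -- (2) upper bound for the difference-seeking utility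
    (∀ ε : ℝ, 0 < ε → ∃ K : ℕ,
      ∀ (V : Type u) (X : Type v) [Fintype V] [Fintype X] (t : ℕ) (G : SimpleGraph V)
        [DecidableRel G.Adj] (typ : X → Fin t), SwapGame.Setting G typ →
        K ≤ Fintype.card V / t →
        SwapGame.priceOfAnarchy (SwapGame.colorfulEdges G typ) (SwapGame.uDiff G typ) ≤
          (1 + ε) * (2 * (G.maxDegree : ℝ) / G.minDegree)) ∧
    -- (2)(i)
    (∀ ε : ℝ, 0 < ε → ∃ (C : ℝ) (K : ℕ),
      ∀ (V : Type u) (X : Type v) [Fintype V] [Fintype X] (t : ℕ) (G : SimpleGraph V)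
        [DecidableRel G.Adj] (typ : X → Fin t), SwapGame.Setting G typ →
        K ≤ Fintype.card V / t →
        C * (1 + (G.minDegree : ℝ) * Real.log G.minDegree) ≤ (t : ℝ) →
        1 ≤ SwapGame.priceOfAnarchy (SwapGame.colorfulEdges G typ) (SwapGame.uDiff G typ) ∧
        SwapGame.priceOfAnarchy (SwapGame.colorfulEdges G typ) (SwapGame.uDiff G typ) ≤
          (1 + ε) * ((G.maxDegree : ℝ) / G.minDegree)) ∧
    -- (2)(ii)
    (∀ a b : ℝ, 0 < a → 0 < b → ∃ c : ℝ, 0 < c ∧ ∀ ε : ℝ, 0 < ε → ∃ K : ℕ,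
      ∀ (V : Type u) (X : Type v) [Fintype V] [Fintype X] (t : ℕ) (G : SimpleGraph V)
        [DecidableRel G.Adj] (typ : X → Fin t), SwapGame.Setting G typ →
        K ≤ Fintype.card V / t →
        a * Real.sqrt G.minDegree ≤ (t : ℝ) → (t : ℝ) ≤ b * G.minDegree →
        SwapGame.priceOfAnarchy (SwapGame.colorfulEdges G typ) (SwapGame.uDiff G typ) ≤
          (1 + ε) * (2 / ((G.minDegree : ℝ) / G.maxDegree +
            c * ((t : ℝ) ^ 2 / ((G.minDegree : ℝ) * G.maxDegree) - 1 / (G.maxDegree : ℝ))))) ∧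
    -- (3) upper bound for the variety-seeking utility
    (∀ ε : ℝ, 0 < ε → ∃ K : ℕ,
      ∀ (V : Type u) (X : Type v) [Fintype V] [Fintype X] (t : ℕ) (G : SimpleGraph V)
        [DecidableRel G.Adj] (typ : X → Fin t), SwapGame.Setting G typ →
        K ≤ Fintype.card V / t →
        SwapGame.priceOfAnarchy (SwapGame.colorfulEdges G typ) (SwapGame.uVariety G typ) ≤
          (1 + ε) * ((G.maxDegree : ℝ) * t / ((t : ℝ) - 1))) ∧
    -- (3)(i)
    (∀ ε : ℝ, 0 < ε → ∃ (C : ℝ) (K : ℕ),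
      ∀ (V : Type u) (X : Type v) [Fintype V] [Fintype X] (t : ℕ) (G : SimpleGraph V)
        [DecidableRel G.Adj] (typ : X → Fin t), SwapGame.Setting G typ →
        K ≤ Fintype.card V / t →
        C * (G.minDegree : ℝ) ^ 3 ≤ (t : ℝ) →
        1 ≤ SwapGame.priceOfAnarchy (SwapGame.colorfulEdges G typ) (SwapGame.uVariety G typ) ∧
        SwapGame.priceOfAnarchy (SwapGame.colorfulEdges G typ) (SwapGame.uVariety G typ) ≤
          (1 + ε) * ((G.maxDegree : ℝ) / G.minDegree)) ∧
    -- (3)(ii)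
    (∀ b : ℝ, 0 < b → ∃ C : ℝ, 0 < C ∧
      ∀ (V : Type u) (X : Type v) [Fintype V] [Fintype X] (t : ℕ) (G : SimpleGraph V)
        [DecidableRel G.Adj] (typ : X → Fin t), SwapGame.Setting G typ →
        1 ≤ Fintype.card V / t →
        (t : ℝ) ≤ b * (G.minDegree : ℝ) ^ 3 →
        SwapGame.priceOfAnarchy (SwapGame.colorfulEdges G typ) (SwapGame.uVariety G typ) ≤
          C * ((G.maxDegree : ℝ) / (t : ℝ) ^ (1 / 3 : ℝ))) ∧
    -- (4)
    (∀ (V : Type u) (X : Type v) [Fintype V] [Fintype X] (t : ℕ) (G : SimpleGraph V)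
        [DecidableRel G.Adj] (typ : X → Fin t), SwapGame.Setting G typ →
        2 ≤ Fintype.card V → G.maxDegree + 1 ≤ t →
        SwapGame.priceOfStability (SwapGame.colorfulEdges G typ) (SwapGame.uDiff G typ) = 1) := by
  refine ⟨?_, ?_, ?_, ?_, ?_, ?_, ?_, ?_, ?_, ?_, ?_, ?_⟩
  · intro V X _ _ t G typ h hn
    refine ⟨?_, ?_, ?_, h.colorfulEdges_pos hn⟩
    · obtain ⟨L, hL, -⟩ := SwapGame.exists_isEquilibrium (SwapGame.uBinary_eq G typ)
        (SwapGame.isPotential_binaryAt G) h.equitable.card_eq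
      exact ⟨L, hL⟩
    · obtain ⟨L, hL, -⟩ := SwapGame.exists_isEquilibrium (SwapGame.uDiff_eq G typ)
        (SwapGame.isPotential_numOther G) h.equitable.card_eq
      exact ⟨L, hL⟩
    · obtain ⟨L, hL, -⟩ := SwapGame.exists_isEquilibrium (SwapGame.uVariety_eq G typ)
        (SwapGame.isPotential_varietyAt G) h.equitable.card_eq
      exact ⟨L, hL⟩
  · intro ε hε
    obtain ⟨K, hK⟩ := exists_nat_ge (1 + (1 + ε) / (2 * ε))
    exact ⟨K, fun V X _ _ t G _ typ h hk => h.priceOfAnarchy_le_of_unhappySwap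
      (SwapGame.uBinary_eq G typ) (SwapGame.isPotential_binaryAt G)
      (SwapGame.unhappySwap_binaryAt G) hε (hK.trans (by exact_mod_cast hk))⟩
  · intro t d q ht hd hdq htq
    exact ⟨SwapGame.ncard_neighborSet_gStar ht hd hdq htq,
      fun X _ typ h => SwapGame.priceOfStability_gStar h ht hd hdq htq⟩
  · intro t d ht hd ε hε
    obtain ⟨Q, hQ⟩ := exists_nat_ge (d * (t + 1) / ε : ℝ)
    refine ⟨max Q (max d t), fun q hq X _ typ h => ?_⟩
    have h1 : Q ≤ q := (le_max_left _ _).trans hq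
    have h2 : d ≤ q := ((le_max_left _ _).trans (le_max_right _ _)).trans hq
    have h3 : t ≤ q := ((le_max_right _ _).trans (le_max_right _ _)).trans hq
    refine (SwapGame.abs_priceOfAnarchy_gStar_sub_le h ht hd h2 (by omega)).trans ?_
    have hq0 : (0 : ℝ) < q := by
      have : 0 < q := by omega
      exact_mod_cast this
    rw [div_le_iff₀ hq0, ← div_le_iff₀' hε]
    exact hQ.trans (by exact_mod_cast h1)
  · intro V X _ _ t G typ _
    exact SwapGame.priceOfAnarchy_socialWelfare_uDiff
  · exact fun ε hε => ⟨6, fun V X _ _ t G _ typ h hk => h.priceOfAnarchy_uDiff_le hε hk⟩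
  · exact fun ε hε => SwapGame.uDiff_many_types hε
  · intro a b _ hb
    obtain ⟨c, hc, h⟩ := SwapGame.uDiff_medium_types.{u, v} hb
    refine ⟨c, hc, fun ε hε => ?_⟩
    obtain ⟨K, hK⟩ := h ε hε
    exact ⟨K, fun V X _ _ t G _ typ hs hk _ ht => hK V X t G typ hs hk ht⟩
  · intro ε hε
    obtain ⟨K, hK⟩ := exists_nat_ge (1 + (1 + ε) / (2 * ε))
    exact ⟨K, fun V X _ _ t G _ typ h hk => h.priceOfAnarchy_le_of_unhappySwap
      (SwapGame.uVariety_eq G typ) (SwapGame.isPotential_varietyAt G)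
      (SwapGame.unhappySwap_varietyAt G) hε (hK.trans (by exact_mod_cast hk))⟩
  · exact fun ε hε => SwapGame.uVariety_many_types hε
  · exact fun b hb => SwapGame.uVariety_few_types hb
  · intro V X _ _ t G _ typ h hn _
    exact SwapGame.priceOfStability_eq_one (SwapGame.uDiff_eq G typ)
      (SwapGame.isPotential_numOther G) h.equitable.card_eq
      ⟨Fintype.equivOfCardEq h.equitable.card_eq, h.colorfulEdges_pos hn _⟩
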